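/- **Setting.** Let $d\ge 1$, let $\Omega\subset\mathbb R^d$ be bounded and open, and let $S_0,S_1$ be the sets on which the pure phases are prescribed; put $\mathcal U=\{\varphi\in L^1(\Omega): \varphi=-1\text{ a.e. on }\Omega\cap S_0,\ \varphi=1\text{ a.e. on }\Omega\cap S_1\}$. Let $b_\varepsilon:[-1,1]\to[0,\overline b_\varepsilon]$ ($\varepsilon>0$) and $b_0:[-1,1]\to[0,+\infty]$ be (not necessarily strictly) decreasing, surjective, continuous functions such that $b_0(0)<\infty$, $b_\varepsilon\to b_0$ pointwise on $[-1,1]$ as $\varepsilon\searrow0$, $b_\delta\ge b_\varepsilon$ on $[-1,1]$ for $0\le\delta\le\varepsilon$, and $\overline b_\varepsilon\to+\infty$, $\overline b_\varepsilon=o(\varepsilon^{-2/3})$ as $\varepsilon\searrow 0$. The convention $\infty\cdot 0=0$ is used. For measurable $\vartheta:\Omega\to[-1,1]$ the *diffuse problem* is: find $0\ne w\in H^1_0(\Omega)$, $\lambda\in\mathbb R$ with $$\int_\Omega\nabla w\cdot\nabla\eta\,dx+\int_\Omega b_\varepsilon(\vartheta)\,w\,\eta\,dx=\lambda\int_\Omega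 w\,\eta\,dx\qquad\forall\,\eta\in H^1_0(\Omega).$$ Let $\lambda_1^{\varepsilon,\vartheta}\le\lambda_2^{\varepsilon,\vartheta}\le\dots$ be its eigenvalues, repeated according to multiplicity, and fix any orthonormal basis $(w_k^{\varepsilon,\vartheta})_{k\ge1}$ of $L^2(\Omega)$ such that $w_k^{\varepsilon,\vartheta}$ is an eigenfunction to $\lambda_k^{\varepsilon,\vartheta}$. For $\varphi:\Omega\to\{\pm1\}$ put $E^\varphi=\{x\in\Omega:\varphi(x)=1\}$ and $V^\varphi=\{\eta\in H^1_0(\Omega):\eta=0\text{ a.e. in }\Omega\setminus E^\varphi\}$. The *limit problem* is: find $0\ne w\in V^\varphi$, $\lambda\in\mathbb R$ with $$\int_\Omega\nabla w\cdot\nabla\eta\,dx=\lambda\int_\Omega w\,\eta\,dx\qquad\forall\,\eta\in V^\varphi.$$ Its eigenvalues, repeated according to multiplicity, are $\lambda_1^{0,\varphi}\le\lambda_2^{0,\varphi}\le\dots$. **Theorem.** Let $\varphi\in BV(\Omega,\{\pm1\})\cap\mathcal U$ be such that $E^\varphi$ contains, up to a null set, an open ball $B\subset\Omega$. Let $(\varepsilon_n)_{n\in\mathbb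 N}$ be a sequence of positive numbers with $\varepsilon_n\to0$, and let $\varphi_n\in L^1(\Omega)$ satisfy $|\varphi_n|\le1$ a.e. in $\Omega$, $$\lim_{n\to\infty}\|\varphi_n-\varphi\|_{L^1(\Omega)}=0\qquad\text{and}\qquad \|\varphi_n-\varphi\|_{L^1(E^\varphi\cap\{\varphi_n<0\})}=O(\varepsilon_n).$$ Then for every $k\ge1$ there are a subsequence, not relabelled, and an eigenfunction $u_k\in V^\varphi$ of the limit problem to the eigenvalue $\lambda_k^{0,\varphi}$ such that along this subsequence $$\lim_{n\to\infty}\int_\Omega b_{\varepsilon_n}(\varphi_n)\,|w_k^{\varepsilon_n,\varphi_n}|^2\,dx=\int_\Omega b_0(\varphi)\,|u_k|^2\,dx=0,$$ $$\lim_{n\to\infty}\|w_k^{\varepsilon_n,\varphi_n}-u_k\|_{H^1(\Omega)}=0,\qquad \lim_{n\to\infty}\lambda_k^{\varepsilon_n,\varphi_n}=\lambda_k^{0,\varphi}.$$ -/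

import Mathlib

open MeasureTheory Filter Topology Set Asymptotics
open scoped ENNReal ContDiff InnerProductSpace

noncomputable section

namespace PhaseField

/-- The space `ℝᵈ` with its Euclidean norm. -/
abbrev Space (d : ℕ) := EuclideanSpace ℝ (Fin d)

variable {d : ℕ}

/-- `L²(Ω)`. -/
abbrev L2 (Ω : Set (Space d)) := Lp ℝ 2 (volume.restrict Ω)

/-- `L²(Ω; ℝᵈ)`. -/
abbrev L2Vec (Ω : Set (Space d)) := Lp (Space d) 2 (volume.restrict Ω)

/-- The Hilbert space `L²(Ω) × L²(Ω; ℝᵈ)`. A Sobolev function `w` is represented by the pair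
`(w, ∇w)`, with components `w.fst` and `w.snd`; the norm of such a pair is
`(∫_Ω |w|² + |∇w|²)^{1/2}`, i.e. the norm of `H¹(Ω)`. -/
abbrev L2Pair (Ω : Set (Space d)) := WithLp 2 (L2 Ω × L2Vec Ω)

/-- `η ∈ C_c^∞(Ω)`. -/
def IsTest (Ω : Set (Space d)) (η : Space d → ℝ) : Prop :=
  ContDiff ℝ ∞ η ∧ HasCompactSupport η ∧ tsupport η ⊆ Ω

/-- `p.snd` is the weak gradient of `p.fst` on `Ω`. -/
def HasWeakGradient (Ω : Set (Space d)) (p : L2Pair Ω) : Prop :=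
  ∀ η : Space d → ℝ, IsTest Ω η → ∀ v : Space d,
    ∫ x in Ω, p.fst x * fderiv ℝ η x v = - ∫ x in Ω, ⟪p.snd x, v⟫_ℝ * η x

/-- The Sobolev space `H¹₀(Ω)`: the closure of `C_c^∞(Ω)` in the `H¹(Ω)`-norm, every function being
represented by the pair of itself and its gradient. -/
def H10 (Ω : Set (Space d)) : Submodule ℝ (L2Pair Ω) :=
  (Submodule.span ℝ {p : L2Pair Ω | ∃ η : Space d → ℝ, IsTest Ω η ∧
    p.fst =ᵐ[volume.restrict Ω] η ∧
    p.snd =ᵐ[volume.restrict Ω] gradient η}).topologicalClosure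

theorem hasWeakGradient_of_mem_H10 {Ω : Set (Space d)} {p : L2Pair Ω} (hp : p ∈ H10 Ω) :
    HasWeakGradient Ω p := by
  intro η hη v
  have hηd : ContDiff ℝ ∞ (fun x => fderiv ℝ η x v) :=
    (hη.1.fderiv_right (m := ∞) (by simp)).clm_apply contDiff_const
  have hm1 : MemLp (fun x => fderiv ℝ η x v) 2 (volume.restrict Ω) :=
    (hηd.continuous.memLp_of_hasCompactSupport (hη.2.1.fderiv_apply ℝ v)).restrict Ω
  have hm2 : MemLp (fun x => η x • v) 2 (volume.restrict Ω) :=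
    ((hη.1.continuous.smul continuous_const).memLp_of_hasCompactSupport
      hη.2.1.smul_right).restrict Ω
  have e1 : ∀ q : L2Pair Ω, ∫ x in Ω, q.fst x * fderiv ℝ η x v = ⟪hm1.toLp, q.fst⟫_ℝ := by
    intro q
    rw [L2.inner_def]
    apply integral_congr_ae
    filter_upwards [hm1.coeFn_toLp] with x hx
    rw [hx]; simp
  have e2 : ∀ q : L2Pair Ω, ∫ x in Ω, ⟪q.snd x, v⟫_ℝ * η x = ⟪hm2.toLp, q.snd⟫_ℝ := by
    intro q
    rw [L2.inner_def]
    apply integral_congr_ae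
    filter_upwards [hm2.coeFn_toLp] with x hx
    rw [hx, inner_smul_left, real_inner_comm]; simp [mul_comm]
  rw [e1, e2]
  let T : L2Pair Ω →L[ℝ] ℝ :=
    (innerSL ℝ hm1.toLp).comp (WithLp.fstL 2 ℝ (L2 Ω) (L2Vec Ω)) +
      (innerSL ℝ hm2.toLp).comp (WithLp.sndL 2 ℝ (L2 Ω) (L2Vec Ω))
  have hT : ∀ q : L2Pair Ω, T q = ⟪hm1.toLp, q.fst⟫_ℝ + ⟪hm2.toLp, q.snd⟫_ℝ := fun q => rfl
  suffices h : H10 Ω ≤ LinearMap.ker (T : L2Pair Ω →ₗ[ℝ] ℝ) by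
    have h0 : T p = 0 := h hp
    rw [hT] at h0
    linarith
  refine Submodule.topologicalClosure_minimal _ (Submodule.span_le.2 ?_) T.isClosed_ker
  rintro q ⟨ζ, hζ, h1, h2⟩
  change T q = 0
  rw [hT, ← e1, ← e2]
  have hcη := hη.1.continuous
  have hcζ := hζ.1.continuous
  have hζd : ContDiff ℝ ∞ (fun x => fderiv ℝ ζ x v) :=
    (hζ.1.fderiv_right (m := ∞) (by simp)).clm_apply contDiff_const
  have i1 : ∫ x in Ω, q.fst x * fderiv ℝ η x v = ∫ x, ζ x * fderiv ℝ η x v := by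
    refine Eq.trans ?_ (setIntegral_eq_integral_of_forall_compl_eq_zero (s := Ω) ?_)
    · apply integral_congr_ae
      filter_upwards [h1] with x hx
      rw [hx]
    · intro x hx
      rw [image_eq_zero_of_notMem_tsupport (fun h => hx (hζ.2.2 h)), zero_mul]
  have i2 : ∫ x in Ω, ⟪q.snd x, v⟫_ℝ * η x = ∫ x, fderiv ℝ ζ x v * η x := by
    refine Eq.trans ?_ (setIntegral_eq_integral_of_forall_compl_eq_zero (s := Ω) ?_)
    · apply integral_congr_ae
      filter_upwards [h2] with x hx
      rw [hx, inner_gradient_left]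
    · intro x hx
      rw [image_eq_zero_of_notMem_tsupport (fun h => hx (hη.2.2 h)), mul_zero]
  rw [i1, i2, integral_mul_fderiv_eq_neg_fderiv_mul_of_integrable
    ((hζd.continuous.mul hcη).integrable_of_hasCompactSupport hη.2.1.mul_left)
    ((hcζ.mul hηd.continuous).integrable_of_hasCompactSupport hζ.2.1.mul_right)
    ((hcζ.mul hcη).integrable_of_hasCompactSupport hζ.2.1.mul_right)
    (fun x _ => (hζ.1.differentiable (by simp)).differentiableAt)
    (fun x _ => (hη.1.differentiable (by simp)).differentiableAt)]
  simp

/-- The set `E^φ = {x ∈ Ω | φ(x) = 1}`. -/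
def plusSet (Ω : Set (Space d)) (φ : Space d → ℝ) : Set (Space d) := {x ∈ Ω | φ x = 1}

/-- The space `V^φ` of all `η ∈ H¹₀(Ω)` with `η = 0` a.e. in `Ω \ E^φ`. -/
def V (Ω : Set (Space d)) (φ : Space d → ℝ) : Submodule ℝ (L2Pair Ω) where
  carrier := {p | p ∈ H10 Ω ∧ ∀ᵐ x ∂(volume.restrict Ω), x ∉ plusSet Ω φ → p.fst x = 0}
  add_mem' := by
    rintro p q ⟨hp, hp'⟩ ⟨hq, hq'⟩
    refine ⟨add_mem hp hq, ?_⟩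
    filter_upwards [hp', hq', Lp.coeFn_add p.fst q.fst] with x h1 h2 h3 hx
    rw [WithLp.add_fst, h3, Pi.add_apply, h1 hx, h2 hx, add_zero]
  zero_mem' := by
    refine ⟨zero_mem _, ?_⟩
    filter_upwards [Lp.coeFn_zero ℝ 2 (volume.restrict Ω)] with x h _
    rw [WithLp.zero_fst, h, Pi.zero_apply]
  smul_mem' := by
    rintro c p ⟨hp, hp'⟩
    refine ⟨Submodule.smul_mem _ c hp, ?_⟩
    filter_upwards [hp', Lp.coeFn_smul c p.fst] with x h1 h2 hx
    rw [WithLp.smul_fst, h2, Pi.smul_apply, h1 hx, smul_zero]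

/-- `w` is an eigenfunction to the eigenvalue `μ` of the problem
`∫ ∇w·∇η + ∫ β w η = μ ∫ w η` for all `η ∈ U`, posed in the space `U` of Sobolev functions. -/
def IsEigenfunction (Ω : Set (Space d)) (U : Submodule ℝ (L2Pair Ω)) (β : Space d → ℝ)
    (μ : ℝ) (w : L2Pair Ω) : Prop :=
  w ∈ U ∧ w.fst ≠ 0 ∧ ∀ η ∈ U,
    (∫ x in Ω, ⟪w.snd x, η.snd x⟫_ℝ) + (∫ x in Ω, β x * w.fst x * η.fst x)
      = μ * ∫ x in Ω, w.fst x * η.fst x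

/-- The eigenvalues of the above problem, repeated according to their multiplicity and numbered in
increasing order from `k = 0` on: the `k`-th one is the least `μ` such that there are `k + 1`
pairwise `L²`-orthonormal eigenfunctions to eigenvalues `≤ μ`. -/
def eigenvalue (Ω : Set (Space d)) (U : Submodule ℝ (L2Pair Ω)) (β : Space d → ℝ) (k : ℕ) : ℝ :=
  sInf {μ : ℝ | ∃ w : Fin (k + 1) → L2Pair Ω, Orthonormal ℝ (fun i => (w i).fst) ∧
    ∀ i, ∃ ν ≤ μ, IsEigenfunction Ω U β ν (w i)}

/-- `w 0, w 1, …` is an orthonormal basis of `L²(Ω)`, and `w k` is an eigenfunction of the Dirichlet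
problem `-Δw + β w = λ w` in `Ω`, `w = 0` on `∂Ω`, to the eigenvalue with number `k`. -/
structure IsEigenbasis (Ω : Set (Space d)) (β : Space d → ℝ) (w : ℕ → L2Pair Ω) : Prop where
  orthonormal : Orthonormal ℝ (fun k => (w k).fst)
  total : (Submodule.span ℝ (range fun k => (w k).fst)).topologicalClosure = ⊤
  eigenfunction : ∀ k, IsEigenfunction Ω (H10 Ω) β (eigenvalue Ω (H10 Ω) β k) (w k)

/-- The divergence of a vector field. -/
def divergence (X : Space d → Space d) (x : Space d) : ℝ :=
  ∑ i, fderiv ℝ X x (EuclideanSpace.single i 1) i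

/-- `φ ∈ BV(Ω)`: `φ ∈ L¹(Ω)` and the total variation of `φ` in `Ω` is finite. -/
def IsBV (Ω : Set (Space d)) (φ : Space d → ℝ) : Prop :=
  IntegrableOn φ Ω ∧
  ∃ C : ℝ, ∀ X : Space d → Space d, ContDiff ℝ 1 X → HasCompactSupport X → tsupport X ⊆ Ω →
    (∀ x, ‖X x‖ ≤ 1) → ∫ x in Ω, φ x * divergence X x ≤ C

/-- `φ ∈ 𝒰`: `φ ∈ L¹(Ω)`, `φ = -1` a.e. on `S₀` and `φ = 1` a.e. on `S₁`. -/
def InU (Ω S₀ S₁ : Set (Space d)) (φ : Space d → ℝ) : Prop :=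
  IntegrableOn φ Ω ∧ (∀ᵐ x ∂(volume.restrict Ω), x ∈ S₀ → φ x = -1) ∧
    (∀ᵐ x ∂(volume.restrict Ω), x ∈ S₁ → φ x = 1)

/-- The assumptions on the coefficient functions `b_ε : [-1,1] → [0, b̄_ε]`, `ε > 0`, and
`b₀ : [-1,1] → [0,∞]`. Only the values on `[-1,1]` of the functions are constrained. -/
structure IsCoefficientFamily (b : ℝ → ℝ → ℝ) (bbar : ℝ → ℝ) (b₀ : ℝ → ℝ≥0∞) : Prop where
  mapsTo : ∀ ε > 0, MapsTo (b ε) (Icc (-1) 1) (Icc 0 (bbar ε))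
  surjOn : ∀ ε > 0, SurjOn (b ε) (Icc (-1) 1) (Icc 0 (bbar ε))
  antitoneOn : ∀ ε > 0, AntitoneOn (b ε) (Icc (-1) 1)
  continuousOn : ∀ ε > 0, ContinuousOn (b ε) (Icc (-1) 1)
  surjOn_zero : SurjOn b₀ (Icc (-1) 1) univ
  antitoneOn_zero : AntitoneOn b₀ (Icc (-1) 1)
  continuousOn_zero : ContinuousOn b₀ (Icc (-1) 1)
  lt_top : b₀ 0 < ⊤
  tendsto : ∀ s ∈ Icc (-1 : ℝ) 1,
    Tendsto (fun ε => ENNReal.ofReal (b ε s)) (𝓝[>] 0) (𝓝 (b₀ s))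
  le_of_le : ∀ δ ε : ℝ, 0 < δ → δ ≤ ε → ∀ s ∈ Icc (-1 : ℝ) 1, b ε s ≤ b δ s
  le_zero : ∀ ε > 0, ∀ s ∈ Icc (-1 : ℝ) 1, ENNReal.ofReal (b ε s) ≤ b₀ s
  bbar_tendsto : Tendsto bbar (𝓝[>] 0) atTop
  bbar_isLittleO : bbar =o[𝓝[>] 0] (fun ε : ℝ => ε ^ (-(2 / 3) : ℝ))

end PhaseField

end

open PhaseField

/-! The penalty is written as a squared norm `‖S n f‖ ^ 2`, where `S n` is multiplication on `L²(Ω)`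
by the square root of the `n`-th coefficient. After passing to a subsequence along which `φε n → φ`
almost everywhere, only two properties of the operators `S n` matter.

Recovery: `S n f → 0` for every fixed bounded `f` in `V^φ`. On `E^φ ∩ {φε n < 0}`, a set of measure
`O(ε n)`, the coefficient is at most `bbar (ε n) = o(ε n ^ (-2/3))`, so this part vanishes in the
limit. On the rest of `E^φ` the coefficient is bounded by `b₀ 0` and tends to `b₀ 1 = 0`, so
dominated convergence applies. Boundedness of `f` is needed because the bad set is controlled only
in measure; it costs nothing, since smooth truncation makes the bounded functions dense in `V^φ`
(`V_le_topologicalClosure_boundedV`).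

Confinement: if `f n → g` in `L²` and `S n (f n)` stays bounded, then `g = 0` off `E^φ`, by Fatou
and because the coefficients blow up where `φ = -1`.

Bounded trial functions and the Rayleigh bound `eigenvalue_mul_norm_sq_le` give an upper bound for
the diffuse eigenvalues. Hence the first `k + 1` eigenfunctions are bounded in `H¹₀`, and Rellich's
theorem (`tendsto_fst_of_weakTendsto`) makes their weak limits orthonormal eigenfunctions of the
limit problem. Their existence bounds the limit of the eigenvalues from below by the limit
eigenvalue, and the trial functions bound it from above. Finally `‖∇w‖² + ‖S n w‖²` equals the
eigenvalue and converges to `‖∇u‖²`; together with weak convergence of the gradients this forces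
both strong convergence in `H¹` and the vanishing of the penalty. -/

namespace PhaseField

/-! ### Weak convergence in Hilbert spaces -/

section WeakConvergence

variable {X : Type*} [NormedAddCommGroup X] [InnerProductSpace ℝ X]

/-- Weak convergence of a sequence in an inner product space. -/
def WeakTendsto (x : ℕ → X) (a : X) : Prop :=
  ∀ y : X, Tendsto (fun n => ⟪x n, y⟫_ℝ) atTop (𝓝 ⟪a, y⟫_ℝ)

theorem WeakTendsto.comp {x : ℕ → X} {a : X} (h : WeakTendsto x a) {σ : ℕ → ℕ}
    (hσ : StrictMono σ) : WeakTendsto (x ∘ σ) a :=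
  fun y => (h y).comp hσ.tendsto_atTop

/-- Sequential Banach–Alaoglu, transported through the Riesz isomorphism. -/
theorem exists_weakTendsto_subseq [CompleteSpace X] [SecondCountableTopology X]
    {x : ℕ → X} {C : ℝ} (hx : ∀ n, ‖x n‖ ≤ C) :
    ∃ a : X, ∃ σ : ℕ → ℕ, StrictMono σ ∧ WeakTendsto (x ∘ σ) a := by
  have hK := WeakDual.isSeqCompact_closedBall ℝ X 0 C
  obtain ⟨f, -, σ, hσ, hf⟩ := hK (x := fun n => StrongDual.toWeakDual
    (InnerProductSpace.toDual ℝ X (x n))) (by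
      intro n
      change InnerProductSpace.toDual ℝ X (x n) ∈ Metric.closedBall 0 C
      simpa using hx n)
  refine ⟨(InnerProductSpace.toDual ℝ X).symm (WeakDual.toStrongDual f), σ, hσ, fun y => ?_⟩
  have := ((WeakDual.eval_continuous y).tendsto f).comp hf
  rw [InnerProductSpace.toDual_symm_apply]
  exact this

theorem WeakTendsto.unique {x : ℕ → X} {a b : X} (ha : WeakTendsto x a) (hb : WeakTendsto x b) :
    a = b :=
  ext_inner_right ℝ fun y => tendsto_nhds_unique (ha y) (hb y)

theorem WeakTendsto.of_tendsto {x : ℕ → X} {a : X} (h : Tendsto x atTop (𝓝 a)) :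
    WeakTendsto x a :=
  fun _ => h.inner tendsto_const_nhds

/-- Weak lower semicontinuity of the norm: test the convergence against the limit itself. -/
theorem WeakTendsto.norm_le {x : ℕ → X} {a : X} (h : WeakTendsto x a) {C : ℝ}
    (hC : ∀ᶠ n in atTop, ‖x n‖ ≤ C) : ‖a‖ ≤ C := by
  rcases eq_or_ne a 0 with rfl | ha
  · obtain ⟨n, hn⟩ := hC.exists
    simpa using (norm_nonneg _).trans hn
  have h1 : ‖a‖ * ‖a‖ ≤ C * ‖a‖ := by
    rw [← real_inner_self_eq_norm_mul_norm]
    refine le_of_tendsto (h a) (hC.mono fun n hn => ?_)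
    exact (real_inner_le_norm _ _).trans (by gcongr)
  exact le_of_mul_le_mul_right h1 (norm_pos_iff.2 ha)

/-- The closure of a subspace is its double orthogonal complement, and orthogonality to a fixed
vector passes to weak limits. -/
theorem Submodule.mem_topologicalClosure_of_weakTendsto [CompleteSpace X] (U : Submodule ℝ X)
    {x : ℕ → X} {a : X} (hx : ∀ n, x n ∈ U) (h : WeakTendsto x a) :
    a ∈ U.topologicalClosure := by
  rw [← Submodule.orthogonal_orthogonal_eq_closure, Submodule.mem_orthogonal']
  intro y hy
  refine tendsto_nhds_unique (h y) ?_
  have : (fun n => ⟪x n, y⟫_ℝ) = fun _ => 0 := by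
    ext n; exact (Submodule.mem_orthogonal _ _).1 hy _ (hx n)
  rw [this]
  exact tendsto_const_nhds

theorem WeakTendsto.map {Y : Type*} [NormedAddCommGroup Y] [InnerProductSpace ℝ Y]
    [CompleteSpace X] [CompleteSpace Y] {x : ℕ → X} {a : X} (h : WeakTendsto x a) (T : X →L[ℝ] Y) :
    WeakTendsto (fun n => T (x n)) (T a) := by
  intro y
  simpa only [← ContinuousLinearMap.adjoint_inner_right] using h (T.adjoint y)

end WeakConvergence

/-! ### The variational characterization of the eigenvalues of a form -/

section MinMax

variable {X L Z : Type*} [AddCommGroup X] [Module ℝ X]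
  [NormedAddCommGroup L] [InnerProductSpace ℝ L]
  [NormedAddCommGroup Z] [InnerProductSpace ℝ Z]

/-- If the form `⟪T ·, T ·⟫` has a complete system of eigenvectors `w` with increasing
eigenvalues `lam` relative to `⟪J ·, J ·⟫`, then its Rayleigh quotient is at least `lam k` on the
vectors orthogonal to `w 0, …, w (k - 1)`. -/
theorem eigenvalue_mul_norm_sq_le [CompleteSpace L] (J : X →ₗ[ℝ] L) (T : X →ₗ[ℝ] Z)
    {U : Submodule ℝ X}
    {w : ℕ → X} {lam : ℕ → ℝ} (hwU : ∀ k, w k ∈ U) (hon : Orthonormal ℝ fun k => J (w k))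
    (htot : (Submodule.span ℝ (range fun k => J (w k))).topologicalClosure = ⊤)
    (hmono : Monotone lam)
    (heig : ∀ k, ∀ η ∈ U, ⟪T (w k), T η⟫_ℝ = lam k * ⟪J (w k), J η⟫_ℝ)
    {k : ℕ} {f : X} (hf : f ∈ U) (horth : ∀ j < k, ⟪J (w j), J f⟫_ℝ = 0) :
    lam k * ‖J f‖ ^ 2 ≤ ‖T f‖ ^ 2 := by
  set c : ℕ → ℝ := fun i => ⟪J (w i), J f⟫_ℝ with hc
  have hsum : HasSum (fun i => c i ^ 2) (‖J f‖ ^ 2) := by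
    have h := (HilbertBasis.mk hon htot.ge).hasSum_inner_mul_inner (J f) (J f)
    rw [real_inner_self_eq_norm_sq] at h
    have h1 : (fun i => c i ^ 2) = fun i => ⟪J f, HilbertBasis.mk hon htot.ge i⟫_ℝ *
        ⟪HilbertBasis.mk hon htot.ge i, J f⟫_ℝ := by
      ext i
      rw [HilbertBasis.coe_mk, real_inner_comm, pow_two]
    rw [h1]
    exact h
  have hTw : ∀ i j, ⟪T (w i), T (w j)⟫_ℝ = if i = j then lam i else 0 := by
    intro i j
    rw [heig i _ (hwU j), orthonormal_iff_ite.1 hon i j]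
    split_ifs <;> simp
  have hbessel : ∀ s : Finset ℕ, ∑ i ∈ s, lam i * c i ^ 2 ≤ ‖T f‖ ^ 2 := by
    intro s
    -- The vectors `T (w i)` are orthogonal with squared norms `lam i`, and `g` is the projection of
    -- `T f` onto the span of those with `i ∈ s`. Bessel's inequality is read off from `0 ≤ ‖T f -
    -- g‖²`, which avoids dividing by a possibly zero `lam i`.
    set g : Z := ∑ i ∈ s, c i • T (w i) with hg
    have h1 : ⟪T f, g⟫_ℝ = ∑ i ∈ s, lam i * c i ^ 2 := by
      rw [hg, inner_sum]
      refine Finset.sum_congr rfl fun i _ => ?_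
      rw [inner_smul_right, real_inner_comm, heig i f hf]
      ring
    have h2 : ⟪g, g⟫_ℝ = ∑ i ∈ s, lam i * c i ^ 2 := by
      rw [hg, sum_inner]
      refine Finset.sum_congr rfl fun i hi => ?_
      rw [inner_smul_left, inner_sum]
      simp only [inner_smul_right, hTw, mul_ite, mul_zero, Finset.sum_ite_eq, hi, if_true]
      simp only [conj_trivial]
      ring
    have h3 := norm_sub_sq_real (T f) g
    rw [← real_inner_self_eq_norm_sq g, h1, h2] at h3
    nlinarith [sq_nonneg ‖T f - g‖]
  have hk : HasSum (fun i => lam k * c i ^ 2) (lam k * ‖J f‖ ^ 2) := hsum.mul_left _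
  refine hasSum_le_of_sum_le hk fun s => le_trans (Finset.sum_le_sum fun i _ => ?_) (hbessel s)
  rcases lt_or_ge i k with h | h
  · simp [hc, horth i h]
  · exact mul_le_mul_of_nonneg_right (hmono h) (sq_nonneg _)

/-- A `k + 1`-dimensional coefficient space contains a unit vector satisfying `k` linear
equations. -/
theorem exists_unit_coeff_orthogonal {k : ℕ} (v : Fin (k + 1) → L) (y : ℕ → L) :
    ∃ c : Fin (k + 1) → ℝ, ∑ i, c i ^ 2 = 1 ∧ ∀ j < k, ⟪y j, ∑ i, c i • v i⟫_ℝ = 0 := by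
  let A : EuclideanSpace ℝ (Fin (k + 1)) →ₗ[ℝ] (Fin k → ℝ) :=
    { toFun := fun c j => ⟪y j, ∑ i, c i • v i⟫_ℝ
      map_add' := by
        intro a b; ext j
        simp [add_smul, Finset.sum_add_distrib, inner_add_right]
      map_smul' := by
        intro a b; ext j
        simp only [PiLp.smul_apply, smul_eq_mul, mul_smul, ← Finset.smul_sum, inner_smul_right,
          Pi.smul_apply, RingHom.id_apply] }
  have hA : LinearMap.ker A ≠ ⊥ := LinearMap.ker_ne_bot_of_finrank_lt (by simp)
  obtain ⟨c, hc, hc0⟩ := (Submodule.ne_bot_iff _).1 hA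
  have hpos : ‖c‖ ≠ 0 := norm_ne_zero_iff.2 hc0
  refine ⟨fun i => (‖c‖⁻¹ • c) i, ?_, fun j hj => ?_⟩
  · have : ‖(‖c‖⁻¹ • c)‖ ^ 2 = 1 := by
      rw [norm_smul, norm_inv, norm_norm, inv_mul_cancel₀ hpos, one_pow]
    simpa only [EuclideanSpace.norm_sq_eq, Real.norm_eq_abs, sq_abs] using this
  · have : A (‖c‖⁻¹ • c) = 0 := by rw [map_smul, LinearMap.mem_ker.1 hc, smul_zero]
    exact congrFun this ⟨j, hj⟩

theorem norm_sum_smul_le {k : ℕ} {c : Fin (k + 1) → ℝ} (hc : ∑ i, c i ^ 2 = 1) (v : Fin (k + 1) → L)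
    {δ : ℝ} (hv : ∀ i, ‖v i‖ ≤ δ) : ‖∑ i, c i • v i‖ ≤ (k + 1) * δ := by
  have hc1 : ∀ i, |c i| ≤ 1 := fun i => by
    rw [← sq_le_one_iff_abs_le_one, ← hc]
    exact Finset.single_le_sum (f := fun i => c i ^ 2) (fun i _ => sq_nonneg _) (Finset.mem_univ i)
  refine (norm_sum_le _ _).trans ((Finset.sum_le_card_nsmul _ _ δ fun i _ => ?_).trans_eq (by simp))
  rw [norm_smul, Real.norm_eq_abs]
  exact (mul_le_of_le_one_left (norm_nonneg _) (hc1 i)).trans (hv i)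

end MinMax

/-! ### Elementary facts on `L²` -/

instance instSecondCountableTopologyL2Pair {d : ℕ} (Ω : Set (Space d)) :
    SecondCountableTopology (L2Pair Ω) := by
  have : Fact ((2 : ℝ≥0∞) ≠ ⊤) := ⟨by simp⟩
  have : SecondCountableTopology (L2 Ω) := Lp.SecondCountableTopology
  have : SecondCountableTopology (L2Vec Ω) := Lp.SecondCountableTopology
  exact WithLp.secondCountableTopology 2 _ _

/-! ### Test functions as elements of `H¹₀` -/

section TestFunctions

variable {d : ℕ} {Ω : Set (Space d)} {η : Space d → ℝ}

theorem gradient_apply (η : Space d → ℝ) (x : Space d) :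
    gradient η x = (InnerProductSpace.toDual ℝ (Space d)).symm (fderiv ℝ η x) := rfl

theorem IsTest.continuous_gradient (hη : IsTest Ω η) : Continuous (gradient η) :=
  (InnerProductSpace.toDual ℝ (Space d)).symm.continuous.comp
    (hη.1.continuous_fderiv (by simp))

theorem IsTest.hasCompactSupport_gradient (hη : IsTest Ω η) : HasCompactSupport (gradient η) :=
  (hη.2.1.fderiv ℝ).comp_left (g := (InnerProductSpace.toDual ℝ (Space d)).symm) (map_zero _)

theorem IsTest.memLp (hη : IsTest Ω η) : MemLp η 2 (volume.restrict Ω) :=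
  (hη.1.continuous.memLp_of_hasCompactSupport hη.2.1).restrict Ω

theorem IsTest.memLp_gradient (hη : IsTest Ω η) : MemLp (gradient η) 2 (volume.restrict Ω) :=
  (hη.continuous_gradient.memLp_of_hasCompactSupport hη.hasCompactSupport_gradient).restrict Ω

theorem IsTest.eq_zero_of_notMem (hη : IsTest Ω η) {x : Space d} (hx : x ∉ Ω) : η x = 0 :=
  image_eq_zero_of_notMem_tsupport fun h => hx (hη.2.2 h)

theorem IsTest.gradient_eq_zero_of_notMem (hη : IsTest Ω η) {x : Space d} (hx : x ∉ Ω) :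
    gradient η x = 0 := by
  rw [gradient_apply, fderiv_of_notMem_tsupport (𝕜 := ℝ) (fun h => hx (hη.2.2 h)), map_zero]

/-- The element `(η, ∇η)` of `H¹₀(Ω)`. -/
noncomputable def testPair (hη : IsTest Ω η) : L2Pair Ω :=
  WithLp.toLp 2 (hη.memLp.toLp, hη.memLp_gradient.toLp)

theorem testPair_fst (hη : IsTest Ω η) : (testPair hη).fst =ᵐ[volume.restrict Ω] η :=
  hη.memLp.coeFn_toLp

theorem testPair_snd (hη : IsTest Ω η) : (testPair hη).snd =ᵐ[volume.restrict Ω] gradient η :=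
  hη.memLp_gradient.coeFn_toLp

theorem testPair_mem_H10 (hη : IsTest Ω η) : testPair hη ∈ H10 Ω :=
  Submodule.le_topologicalClosure _
    (Submodule.subset_span ⟨η, hη, testPair_fst hη, testPair_snd hη⟩)

theorem L2Pair.norm_sq_eq (p : L2Pair Ω) : ‖p‖ ^ 2 = ‖p.fst‖ ^ 2 + ‖p.snd‖ ^ 2 :=
  WithLp.prod_norm_sq_eq_of_L2 p

theorem L2Pair.norm_fst_le (p : L2Pair Ω) : ‖p.fst‖ ≤ ‖p‖ :=
  le_of_sq_le_sq (by rw [L2Pair.norm_sq_eq p]; nlinarith [sq_nonneg ‖p.snd‖]) (norm_nonneg _)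

theorem L2Pair.norm_snd_le (p : L2Pair Ω) : ‖p.snd‖ ≤ ‖p‖ :=
  le_of_sq_le_sq (by rw [L2Pair.norm_sq_eq p]; nlinarith [sq_nonneg ‖p.fst‖]) (norm_nonneg _)

/-- Passing to an integral over the whole space makes translation invariance available in Rellich's
theorem. -/
theorem norm_sq_testPair_fst (hη : IsTest Ω η) : ‖(testPair hη).fst‖ ^ 2 = ∫ x, η x ^ 2 := by
  have h : ∫ x in Ω, η x ^ 2 = ∫ x, η x ^ 2 :=
    setIntegral_eq_integral_of_forall_compl_eq_zero fun x hx => by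
      rw [hη.eq_zero_of_notMem hx]; simp
  rw [← h, ← real_inner_self_eq_norm_sq, L2.inner_def]
  refine integral_congr_ae ?_
  filter_upwards [testPair_fst hη] with x hx
  rw [hx, real_inner_self_eq_norm_sq, Real.norm_eq_abs, sq_abs]

theorem norm_sq_testPair_snd (hη : IsTest Ω η) :
    ‖(testPair hη).snd‖ ^ 2 = ∫ x, ‖gradient η x‖ ^ 2 := by
  have h : ∫ x in Ω, ‖gradient η x‖ ^ 2 = ∫ x, ‖gradient η x‖ ^ 2 :=
    setIntegral_eq_integral_of_forall_compl_eq_zero fun x hx => by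
      rw [hη.gradient_eq_zero_of_notMem hx]; simp
  rw [← h, ← real_inner_self_eq_norm_sq, L2.inner_def]
  refine integral_congr_ae ?_
  filter_upwards [testPair_snd hη] with x hx
  rw [hx, real_inner_self_eq_norm_sq]

/-- The generators of `H10` already form a subspace, so the span adds nothing. -/
theorem exists_isTest_of_mem_span {p : L2Pair Ω}
    (hp : p ∈ Submodule.span ℝ {p : L2Pair Ω | ∃ η : Space d → ℝ, IsTest Ω η ∧
      p.fst =ᵐ[volume.restrict Ω] η ∧ p.snd =ᵐ[volume.restrict Ω] gradient η}) :
    ∃ η : Space d → ℝ, IsTest Ω η ∧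
      p.fst =ᵐ[volume.restrict Ω] η ∧ p.snd =ᵐ[volume.restrict Ω] gradient η := by
  induction hp using Submodule.span_induction with
  | mem x hx => exact hx
  | zero =>
    refine ⟨0, ⟨contDiff_const, HasCompactSupport.zero, by simp [tsupport]⟩,
      Lp.coeFn_zero _ _ _, ?_⟩
    refine (Lp.coeFn_zero _ _ _).trans (Eventually.of_forall fun x => ?_)
    rw [gradient_apply]
    simp
  | add x y _ _ hx hy =>
    obtain ⟨η, hη, h1, h2⟩ := hx
    obtain ⟨ζ, hζ, h3, h4⟩ := hy
    refine ⟨η + ζ, ⟨hη.1.add hζ.1, hη.2.1.add hζ.2.1,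
      (tsupport_add η ζ).trans (union_subset hη.2.2 hζ.2.2)⟩,
      (Lp.coeFn_add _ _).trans (h1.add h3), (Lp.coeFn_add _ _).trans ((h2.add h4).trans ?_)⟩
    refine Eventually.of_forall fun x => ?_
    simp only [gradient_apply, Pi.add_apply]
    rw [fderiv_add (hη.1.differentiable (by simp)).differentiableAt
      (hζ.1.differentiable (by simp)).differentiableAt, map_add]
  | smul c x _ hx =>
    obtain ⟨η, hη, h1, h2⟩ := hx
    refine ⟨c • η, ⟨hη.1.const_smul c, hη.2.1.smul_left (f := fun _ => c),
      (tsupport_smul_subset_right (fun _ => c) η).trans hη.2.2⟩,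
      (Lp.coeFn_smul _ _).trans (h1.const_smul c),
      (Lp.coeFn_smul _ _).trans ((h2.const_smul c).trans ?_)⟩
    refine Eventually.of_forall fun x => ?_
    simp only [gradient_apply, Pi.smul_apply]
    rw [fderiv_const_smul (hη.1.differentiable (by simp)).differentiableAt, map_smul]

theorem exists_testPair_norm_sub_lt {p : L2Pair Ω} (hp : p ∈ H10 Ω) {δ : ℝ} (hδ : 0 < δ) :
    ∃ η : Space d → ℝ, ∃ hη : IsTest Ω η, ‖p - testPair hη‖ < δ := by
  obtain ⟨q, hq, hpq⟩ := Metric.mem_closure_iff.1 hp δ hδ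
  obtain ⟨η, hη, h1, h2⟩ := exists_isTest_of_mem_span hq
  have : q = testPair hη := by
    refine (WithLp.ofLp_injective 2) (Prod.ext ?_ ?_)
    · exact Lp.ext (h1.trans (testPair_fst hη).symm)
    · exact Lp.ext (h2.trans (testPair_snd hη).symm)
  exact ⟨η, hη, by rwa [← this, ← dist_eq_norm]⟩

/-- Weak gradients are unique: an element of `H¹₀(Ω)` is determined by its first component. -/
theorem eq_of_fst_eq_of_mem_H10 (hΩ : IsOpen Ω) {p q : L2Pair Ω} (hp : p ∈ H10 Ω) (hq : q ∈ H10 Ω)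
    (h : p.fst = q.fst) : p = q := by
  have hr : HasWeakGradient Ω (p - q) := hasWeakGradient_of_mem_H10 (sub_mem hp hq)
  have hfst : (p - q).fst = 0 := by rw [WithLp.sub_fst, h, sub_self]
  have hsnd : (p - q).snd = 0 := by
    have hv : ∀ v : Space d, ∀ᵐ x ∂(volume.restrict Ω), ⟪(p - q).snd x, v⟫_ℝ = 0 := by
      intro v
      rw [ae_restrict_iff' hΩ.measurableSet]
      -- Fundamental lemma of the calculus of variations: the difference has zero function part, so
      -- its gradient annihilates all test functions.
      refine hΩ.ae_eq_zero_of_integral_contDiff_smul_eq_zero ?_ fun g hg1 hg2 hg3 => ?_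
      · have h1 : MemLp (fun x => ⟪(p - q).snd x, v⟫_ℝ) 2 (volume.restrict Ω) :=
          (Lp.memLp (p - q).snd).inner_const v
        intro x hx
        obtain ⟨r, hr, hrΩ⟩ := Metric.isOpen_iff.1 hΩ x hx
        refine ⟨Metric.ball x r, mem_nhdsWithin_of_mem_nhds (Metric.ball_mem_nhds x hr), ?_⟩
        have : IsFiniteMeasure (volume.restrict (Metric.ball x r)) :=
          ⟨by simpa using measure_ball_lt_top⟩
        exact (h1.mono_measure (Measure.restrict_mono hrΩ le_rfl)).integrable (by norm_num)
      · have h2 := hr g ⟨hg1, hg2, hg3⟩ v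
        have h3 : ∫ x in Ω, (p - q).fst x * fderiv ℝ g x v = 0 := by
          rw [hfst]
          refine integral_eq_zero_of_ae ?_
          filter_upwards [Lp.coeFn_zero ℝ 2 (volume.restrict Ω)] with x hx
          rw [hx]; simp
        rw [h3] at h2
        rw [← setIntegral_eq_integral_of_forall_compl_eq_zero (s := Ω)]
        · simp only [smul_eq_mul, mul_comm (g _)]
          linarith
        · intro x hx
          rw [image_eq_zero_of_notMem_tsupport fun h => hx (hg3 h), zero_smul]
    refine Lp.ext ?_
    have hall : ∀ᵐ x ∂(volume.restrict Ω), ∀ i : Fin d,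
        ⟪(p - q).snd x, EuclideanSpace.single i (1 : ℝ)⟫_ℝ = 0 :=
      ae_all_iff.2 fun i => hv _
    filter_upwards [hall, Lp.coeFn_zero (Space d) 2 (volume.restrict Ω)] with x hx h0
    rw [h0]
    ext i
    simpa [EuclideanSpace.inner_single_right] using hx i
  rw [← sub_eq_zero]
  exact (WithLp.ofLp_injective 2) (Prod.ext hfst hsnd)

end TestFunctions

/-! ### Rellich's theorem for `H¹₀` -/

section Rellich

variable {d : ℕ} {Ω : Set (Space d)} {η : Space d → ℝ}

/-- Jensen's inequality, as nonnegativity of the variance. -/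
theorem sq_intervalIntegral_le {g : ℝ → ℝ} (hg : Continuous g) :
    (∫ t in (0 : ℝ)..1, g t) ^ 2 ≤ ∫ t in (0 : ℝ)..1, g t ^ 2 := by
  set m := ∫ t in (0 : ℝ)..1, g t with hm
  have h1 : 0 ≤ ∫ t in (0 : ℝ)..1, (g t - m) ^ 2 :=
    intervalIntegral.integral_nonneg zero_le_one fun t _ => sq_nonneg _
  have h2 : ∫ t in (0 : ℝ)..1, (g t - m) ^ 2 =
      (∫ t in (0 : ℝ)..1, g t ^ 2) - 2 * m * m + m ^ 2 := by
    have : ∀ t, (g t - m) ^ 2 = g t ^ 2 - 2 * m * g t + m ^ 2 := fun t => by ring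
    simp only [this]
    rw [intervalIntegral.integral_add, intervalIntegral.integral_sub,
      intervalIntegral.integral_const_mul, intervalIntegral.integral_const, ← hm]
    · simp
    all_goals exact Continuous.intervalIntegrable (by fun_prop) _ _
  nlinarith

theorem IsTest.sq_sub_le (hη : IsTest Ω η) (x h : Space d) :
    (η (x + h) - η x) ^ 2 ≤ ∫ t in (0 : ℝ)..1, ‖h‖ ^ 2 * ‖gradient η (x + t • h)‖ ^ 2 := by
  have hd : Continuous (gradient η) := hη.continuous_gradient
  have hderiv : ∀ t : ℝ,
      HasDerivAt (fun t : ℝ => η (x + t • h)) ⟪gradient η (x + t • h), h⟫_ℝ t := by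
    intro t
    have h1 : HasDerivAt (fun t : ℝ => x + t • h) h t := by
      simpa using ((hasDerivAt_id t).smul_const h).const_add x
    have h2 := ((hη.1.differentiable (by simp)).differentiableAt (x := x + t • h)).hasFDerivAt
    have h3 := h2.comp_hasDerivAt t h1
    rwa [← inner_gradient_left] at h3
  have hcont : Continuous fun t : ℝ => ⟪gradient η (x + t • h), h⟫_ℝ := by fun_prop
  have hftc := intervalIntegral.integral_eq_sub_of_hasDerivAt (a := 0) (b := 1)
    (fun t _ => hderiv t) (hcont.intervalIntegrable _ _)
  simp only [one_smul, zero_smul, add_zero] at hftc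
  rw [← hftc]
  refine (sq_intervalIntegral_le hcont).trans ?_
  refine intervalIntegral.integral_mono_on zero_le_one
    (Continuous.intervalIntegrable (by fun_prop) _ _)
    (Continuous.intervalIntegrable (by fun_prop) _ _) fun t _ => ?_
  rw [← mul_pow, mul_comm ‖h‖, ← sq_abs]
  gcongr
  exact abs_real_inner_le_norm _ _

/-- Integrate the bound along the segment from `x` to `x + h`, exchange the integrals and translate.
Lower Lebesgue integrals are used so that Tonelli needs no integrability. -/
theorem IsTest.integral_sq_sub_le (hη : IsTest Ω η) (h : Space d) :
    ∫ x, (η (x + h) - η x) ^ 2 ≤ ‖h‖ ^ 2 * ∫ x, ‖gradient η x‖ ^ 2 := by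
  have hc : Continuous η := hη.1.continuous
  have hd : Continuous (gradient η) := hη.continuous_gradient
  have hi : Integrable fun x => ‖gradient η x‖ ^ 2 :=
    Continuous.integrable_of_hasCompactSupport (by fun_prop)
      (hη.hasCompactSupport_gradient.comp_left (g := fun v : Space d => ‖v‖ ^ 2) (by simp))
  rw [← integral_const_mul, integral_eq_lintegral_of_nonneg_ae
    (Eventually.of_forall fun x => sq_nonneg _)
    (Continuous.aestronglyMeasurable (by fun_prop))]
  refine ENNReal.toReal_le_of_le_ofReal (integral_nonneg fun x => by positivity) ?_
  rw [ofReal_integral_eq_lintegral_ofReal (hi.const_mul _)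
    (Eventually.of_forall fun x => by positivity)]
  calc ∫⁻ x, ENNReal.ofReal ((η (x + h) - η x) ^ 2)
      ≤ ∫⁻ x, ∫⁻ t in Ioc (0 : ℝ) 1, ENNReal.ofReal (‖h‖ ^ 2 * ‖gradient η (x + t • h)‖ ^ 2) := by
        refine lintegral_mono fun x => ?_
        have hxi : Integrable (fun t : ℝ => ‖h‖ ^ 2 * ‖gradient η (x + t • h)‖ ^ 2)
            (volume.restrict (Ioc 0 1)) :=
          (Continuous.integrableOn_Icc (by fun_prop)).mono_set Ioc_subset_Icc_self
        rw [← ofReal_integral_eq_lintegral_ofReal hxi (Eventually.of_forall fun t => by positivity),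
          ← intervalIntegral.integral_of_le zero_le_one]
        exact ENNReal.ofReal_le_ofReal (hη.sq_sub_le x h)
    _ = ∫⁻ t in Ioc (0 : ℝ) 1, ∫⁻ x, ENNReal.ofReal (‖h‖ ^ 2 * ‖gradient η (x + t • h)‖ ^ 2) := by
        refine lintegral_lintegral_swap (Continuous.aemeasurable ?_)
        exact ENNReal.continuous_ofReal.comp (by fun_prop)
    _ = ∫⁻ t in Ioc (0 : ℝ) 1, ∫⁻ x, ENNReal.ofReal (‖h‖ ^ 2 * ‖gradient η x‖ ^ 2) := by
        refine lintegral_congr fun t => ?_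
        exact lintegral_add_right_eq_self
          (fun x => ENNReal.ofReal (‖h‖ ^ 2 * ‖gradient η x‖ ^ 2)) (t • h)
    _ = ∫⁻ x, ENNReal.ofReal (‖h‖ ^ 2 * ‖gradient η x‖ ^ 2) := by simp

/-- Supplies the integrability for Fubini when averaging over the shift `h`. -/
theorem IsTest.hasCompactSupport_shear (hη : IsTest Ω η) :
    HasCompactSupport (Function.uncurry fun x h : Space d => η x * η (x + h)) := by
  refine HasCompactSupport.intro (K := (fun z : Space d × Space d => (z.1, z.2 - z.1)) ''
    (tsupport η ×ˢ tsupport η)) ((hη.2.1.isCompact.prod hη.2.1.isCompact).image (by fun_prop)) ?_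
  rintro ⟨x, h⟩ hxh
  simp only [Function.uncurry_apply_pair]
  by_contra hne
  refine hxh ⟨(x, x + h), ⟨?_, ?_⟩, by simp⟩
  · exact subset_tsupport _ (left_ne_zero_of_mul hne)
  · exact subset_tsupport _ (right_ne_zero_of_mul hne)

theorem IsTest.integral_sq_le (hη : IsTest Ω η) {h : Space d} {δ : ℝ} (hh : ‖h‖ ≤ δ) :
    ∫ x, η x ^ 2 ≤ δ ^ 2 / 2 * (∫ x, ‖gradient η x‖ ^ 2) + ∫ x, η x * η (x + h) := by
  have hc : Continuous η := hη.1.continuous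
  have hi : Integrable fun x => η x ^ 2 :=
    Continuous.integrable_of_hasCompactSupport (by fun_prop)
      (hη.2.1.comp_left (g := fun v : ℝ => v ^ 2) (by simp))
  have hi2 : Integrable fun x => η x * η (x + h) :=
    Continuous.integrable_of_hasCompactSupport (by fun_prop) hη.2.1.mul_right
  have hi3 : Integrable fun x => η (x + h) ^ 2 := hi.comp_add_right h
  have h1 : ∫ x, (η (x + h) - η x) ^ 2 = 2 * (∫ x, η x ^ 2) - 2 * ∫ x, η x * η (x + h) := by
    have : ∀ x, (η (x + h) - η x) ^ 2 = η (x + h) ^ 2 + η x ^ 2 - 2 * (η x * η (x + h)) :=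
      fun x => by ring
    simp only [this]
    have hi4 : Integrable fun x => η (x + h) ^ 2 + η x ^ 2 := hi3.add hi
    rw [integral_sub hi4 (hi2.const_mul 2), integral_add hi3 hi, integral_const_mul,
      integral_add_right_eq_self (fun x => η x ^ 2) h]
    ring
  have h2 := hη.integral_sq_sub_le h
  have h3 : ‖h‖ ^ 2 * ∫ x, ‖gradient η x‖ ^ 2 ≤ δ ^ 2 * ∫ x, ‖gradient η x‖ ^ 2 := by
    have : 0 ≤ ∫ x, ‖gradient η x‖ ^ 2 := integral_nonneg fun x => sq_nonneg _
    gcongr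
  linarith

/-- Averaging `integral_sq_le` over all shifts in the ball turns the correlation of `η` with its
translates into a pairing of `η` with its ball averages. -/
theorem IsTest.measureReal_ball_mul_integral_sq_le (hη : IsTest Ω η) (δ : ℝ) :
    volume.real (Metric.ball (0 : Space d) δ) * ∫ x, η x ^ 2 ≤
      volume.real (Metric.ball (0 : Space d) δ) * (δ ^ 2 / 2 * ∫ x, ‖gradient η x‖ ^ 2) +
        ∫ x, η x * ∫ y in Metric.ball x δ, η y := by
  have hc : Continuous η := hη.1.continuous
  have hcs := hη.hasCompactSupport_shear
  have hcu : Continuous (Function.uncurry fun x h : Space d => η x * η (x + h)) := by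
    unfold Function.uncurry; fun_prop
  set B := Metric.ball (0 : Space d) δ
  have hfin : IsFiniteMeasure (volume.restrict B) := ⟨by simpa using measure_ball_lt_top⟩
  have hint : Integrable (Function.uncurry fun x h : Space d => η x * η (x + h))
      (volume.prod (volume.restrict B)) := hcu.integrable_of_hasCompactSupport hcs
  have hswap : ∫ h in B, ∫ x, η x * η (x + h) = ∫ x, η x * ∫ y in Metric.ball x δ, η y := by
    rw [← integral_integral_swap hint]
    refine integral_congr_ae (Eventually.of_forall fun x => ?_)
    simp only
    rw [integral_const_mul]
    congr 1
    have he : MeasurableEmbedding (fun y : Space d => x + y) :=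
      (Homeomorph.addLeft x).measurableEmbedding
    rw [← (measurePreserving_add_left volume x).setIntegral_preimage_emb he η (Metric.ball x δ)]
    congr 2
    ext y
    simp [B, dist_eq_norm]
  rw [← hswap]
  have hL : volume.real B * ∫ x, η x ^ 2 = ∫ _ in B, ∫ x, η x ^ 2 := by simp
  have hR : volume.real B * (δ ^ 2 / 2 * ∫ x, ‖gradient η x‖ ^ 2) =
    ∫ _ in B, (δ ^ 2 / 2 * ∫ x, ‖gradient η x‖ ^ 2) := by simp
  have hr : Integrable (fun h => ∫ x, η x * η (x + h)) (volume.restrict B) :=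
    hint.integral_prod_right
  rw [hL, hR, ← integral_add (integrable_const _) hr]
  refine setIntegral_mono_on (integrable_const _)
    ((integrable_const _).add hr) measurableSet_ball fun h hh => ?_
  exact hη.integral_sq_le (by simpa using (mem_ball_zero_iff.1 hh).le)

/-- The average of an `L²` function over balls, up to the factor `|B_δ|`. -/
theorem IsTest.setIntegral_ball_eq (hη : IsTest Ω η) (x : Space d) (δ : ℝ) :
    ∫ y in Metric.ball x δ, η y =
      ⟪indicatorConstLp 2 (μ := volume.restrict Ω) (measurableSet_ball (x := x) (ε := δ))
        ((Measure.restrict_apply_le _ _).trans_lt measure_ball_lt_top).ne (1 : ℝ),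
        (testPair hη).fst⟫_ℝ := by
  rw [L2.inner_indicatorConstLp_one, setIntegral_congr_ae (g := η) measurableSet_ball
    ((testPair_fst hη).mono fun y hy _ => hy), Measure.restrict_restrict measurableSet_ball,
    inter_comm, ← setIntegral_indicator measurableSet_ball,
    ← integral_indicator measurableSet_ball]
  refine (setIntegral_eq_integral_of_forall_compl_eq_zero fun y hy => ?_).symm
  simp [indicator, hη.eq_zero_of_notMem hy]

/-- At fixed radius `δ`, the ball averages of a weakly null sequence tend to zero pointwise and are
uniformly bounded, hence tend to zero in `L²(Ω)`. What the averaging loses is at most `δ² C² / 2`,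
uniformly in `n`. -/
theorem tendsto_norm_testPair_fst (hΩb : Bornology.IsBounded Ω)
    {η : ℕ → Space d → ℝ} (hη : ∀ n, IsTest Ω (η n)) {C : ℝ}
    (hC : ∀ n, ‖testPair (hη n)‖ ≤ C) (hweak : WeakTendsto (fun n => testPair (hη n)) 0) :
    Tendsto (fun n => ‖(testPair (hη n)).fst‖ ^ 2) atTop (𝓝 0) := by
  have hC0 : 0 ≤ C := (norm_nonneg _).trans (hC 0)
  have hfin : IsFiniteMeasure (volume.restrict Ω) := ⟨by simpa using hΩb.measure_lt_top⟩
  have hweak1 : WeakTendsto (fun n => (testPair (hη n)).fst) 0 :=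
    hweak.map (WithLp.fstL 2 ℝ (L2 Ω) (L2Vec Ω))
  rw [Metric.tendsto_nhds]
  intro e he
  obtain ⟨δ, hδ, hδe⟩ : ∃ δ : ℝ, 0 < δ ∧ δ ^ 2 / 2 * C ^ 2 < e / 2 := by
    have : Tendsto (fun δ : ℝ => δ ^ 2 / 2 * C ^ 2) (𝓝[>] 0) (𝓝 (0 ^ 2 / 2 * C ^ 2)) :=
      Tendsto.mono_left (Continuous.tendsto (by fun_prop) 0) nhdsWithin_le_nhds
    obtain ⟨δ, h1, h2⟩ := ((this.eventually_lt_const (u := e / 2) (by simpa using he)).and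
      self_mem_nhdsWithin).exists
    exact ⟨δ, h2, h1⟩
  set m := volume.real (Metric.ball (0 : Space d) δ) with hm
  have hmpos : 0 < m :=
    ENNReal.toReal_pos (Metric.measure_ball_pos _ _ hδ).ne' measure_ball_lt_top.ne
  let g : ℕ → Space d → ℝ := fun n x => ∫ y in Metric.ball x δ, η n y
  have hχ : ∀ x : Space d, ‖indicatorConstLp 2 (μ := volume.restrict Ω)
      (measurableSet_ball (x := x) (ε := δ))
      ((Measure.restrict_apply_le _ _).trans_lt measure_ball_lt_top).ne (1 : ℝ)‖ ≤ √m := by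
    intro x
    rw [norm_indicatorConstLp (by simp) (by simp)]
    simp only [norm_one, one_mul, ENNReal.toReal_ofNat]
    rw [Real.sqrt_eq_rpow, hm]
    gcongr
    rw [measureReal_def, measureReal_def]
    refine ENNReal.toReal_mono measure_ball_lt_top.ne ((Measure.restrict_apply_le _ _).trans ?_)
    rw [Measure.addHaar_ball_center volume x δ]
  have hgbd : ∀ n x, |g n x| ≤ √m * C := by
    intro n x
    simp only [g]
    rw [(hη n).setIntegral_ball_eq]
    refine (abs_real_inner_le_norm _ _).trans ?_
    exact mul_le_mul (hχ x) ((L2Pair.norm_fst_le _).trans (hC n)) (norm_nonneg _) (by positivity)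
  have hglim : ∀ x, Tendsto (fun n => g n x) atTop (𝓝 0) := by
    intro x
    have := hweak1 (indicatorConstLp 2 (μ := volume.restrict Ω)
      (measurableSet_ball (x := x) (ε := δ))
      ((Measure.restrict_apply_le _ _).trans_lt measure_ball_lt_top).ne (1 : ℝ))
    simp only [inner_zero_left] at this
    refine this.congr fun n => ?_
    rw [real_inner_comm, ← (hη n).setIntegral_ball_eq]
  have hgm : ∀ n, StronglyMeasurable (g n) := by
    intro n
    have hset : MeasurableSet {z : Space d × Space d | z.2 ∈ Metric.ball z.1 δ} := by
      simp only [Metric.mem_ball]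
      exact (isOpen_lt (by fun_prop) continuous_const).measurableSet
    have h1 : StronglyMeasurable ({z : Space d × Space d | z.2 ∈ Metric.ball z.1 δ}.indicator
        fun z => η n z.2) :=
      (Continuous.stronglyMeasurable ((hη n).1.continuous.comp continuous_snd)).indicator hset
    have h2 := h1.integral_prod_right' (ν := (volume : Measure (Space d)))
    convert h2 using 2 with x
    simp only [g]
    rw [← integral_indicator measurableSet_ball]
    rfl
  have hgL : ∀ n, MemLp (g n) 2 (volume.restrict Ω) := fun n =>
    MemLp.of_bound (hgm n).aestronglyMeasurable (√m * C)
      (Eventually.of_forall fun x => by simpa using hgbd n x)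
  have hgsq : Tendsto (fun n => ‖(hgL n).toLp‖ ^ 2) atTop (𝓝 0) := by
    have h1 : ∀ n, ‖(hgL n).toLp‖ ^ 2 = ∫ x in Ω, g n x ^ 2 := by
      intro n
      rw [← real_inner_self_eq_norm_sq, L2.inner_def]
      refine integral_congr_ae ?_
      filter_upwards [(hgL n).coeFn_toLp] with x hx
      rw [hx, real_inner_self_eq_norm_sq, Real.norm_eq_abs, sq_abs]
    simp only [h1]
    have h2 := tendsto_integral_of_dominated_convergence (μ := volume.restrict Ω)
      (F := fun n x => g n x ^ 2) (f := fun _ => 0) (fun _ => (√m * C) ^ 2)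
      (fun n => ((hgm n).pow 2).aestronglyMeasurable) (integrable_const _)
      (fun n => Eventually.of_forall fun x => by
        rw [Real.norm_eq_abs, abs_pow]
        exact pow_le_pow_left₀ (abs_nonneg _) (hgbd n x) 2)
      (Eventually.of_forall fun x => by simpa using (hglim x).pow 2)
    simpa using h2
  have hgn : Tendsto (fun n => m⁻¹ * (C * ‖(hgL n).toLp‖)) atTop (𝓝 0) := by
    have := ((hgsq.sqrt.const_mul C).const_mul m⁻¹)
    simpa using this
  filter_upwards [hgn.eventually_lt_const (u := e / 2) (by positivity)] with n hn
  rw [dist_zero_right, Real.norm_eq_abs, abs_of_nonneg (sq_nonneg _)]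
  have key := (hη n).measureReal_ball_mul_integral_sq_le δ
  rw [← norm_sq_testPair_fst (hη n), ← norm_sq_testPair_snd (hη n), ← hm] at key
  have hI : ∫ x, η n x * g n x ≤ C * ‖(hgL n).toLp‖ := by
    have h1 : ∫ x, η n x * g n x = ⟪(testPair (hη n)).fst, (hgL n).toLp⟫_ℝ := by
      rw [L2.inner_def, ← setIntegral_eq_integral_of_forall_compl_eq_zero (s := Ω)
        fun x hx => by rw [(hη n).eq_zero_of_notMem hx, zero_mul]]
      refine integral_congr_ae ?_
      filter_upwards [testPair_fst (hη n), (hgL n).coeFn_toLp] with x h1 h2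
      rw [h1, h2]; simp [mul_comm]
    rw [h1]
    exact (real_inner_le_norm _ _).trans
      (mul_le_mul_of_nonneg_right ((L2Pair.norm_fst_le _).trans (hC n)) (norm_nonneg _))
  have hS : ‖(testPair (hη n)).snd‖ ^ 2 ≤ C ^ 2 :=
    pow_le_pow_left₀ (norm_nonneg _) ((L2Pair.norm_snd_le _).trans (hC n)) 2
  have h5 : m * ‖(testPair (hη n)).fst‖ ^ 2 ≤
      m * (δ ^ 2 / 2 * C ^ 2 + m⁻¹ * (C * ‖(hgL n).toLp‖)) := by
    rw [mul_add, mul_inv_cancel_left₀ hmpos.ne']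
    refine key.trans (add_le_add ?_ hI)
    gcongr
  have h6 := le_of_mul_le_mul_left h5 hmpos
  linarith

/-- Rellich's theorem: weak convergence in `H¹₀(Ω)` implies strong convergence in `L²(Ω)`. -/
theorem tendsto_fst_of_weakTendsto (hΩb : Bornology.IsBounded Ω)
    {p : ℕ → L2Pair Ω} {q : L2Pair Ω} (hp : ∀ n, p n ∈ H10 Ω) (hq : q ∈ H10 Ω) {C : ℝ}
    (hC : ∀ n, ‖p n‖ ≤ C) (hweak : WeakTendsto p q) :
    Tendsto (fun n => (p n).fst) atTop (𝓝 q.fst) := by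
  -- The differences `p n - q` are replaced by test functions with error tending to zero in norm,
  -- which preserves boundedness and weak nullity.
  have happrox : ∀ n : ℕ, ∃ η : Space d → ℝ, ∃ hη : IsTest Ω η,
      ‖p n - q - testPair hη‖ < 1 / ((n : ℝ) + 1) := fun n =>
    exists_testPair_norm_sub_lt (sub_mem (hp n) hq) (by positivity)
  choose η hη hlt using happrox
  have hsmall : Tendsto (fun n => p n - q - testPair (hη n)) atTop (𝓝 0) :=
    squeeze_zero_norm (fun n => (hlt n).le) tendsto_one_div_add_atTop_nhds_zero_nat
  have hbd : ∀ n, ‖testPair (hη n)‖ ≤ C + ‖q‖ + 1 := by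
    intro n
    have h1 : testPair (hη n) = p n - q - (p n - q - testPair (hη n)) := by abel
    have h2 : 1 / ((n : ℝ) + 1) ≤ 1 := by
      rw [div_le_one (by positivity)]; linarith [n.cast_nonneg (α := ℝ)]
    rw [h1]
    refine (norm_sub_le _ _).trans (add_le_add ((norm_sub_le _ _).trans ?_) ((hlt n).le.trans h2))
    gcongr
    exact hC n
  have hw : WeakTendsto (fun n => testPair (hη n)) 0 := by
    intro y
    have h1 := ((hweak y).sub_const ⟪q, y⟫_ℝ).sub (WeakTendsto.of_tendsto hsmall y)
    simp only [inner_zero_left, sub_self] at h1 ⊢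
    refine h1.congr fun n => ?_
    rw [← inner_sub_left, ← inner_sub_left, sub_sub_cancel]
  have h1 : Tendsto (fun n => (testPair (hη n)).fst) atTop (𝓝 0) := by
    rw [tendsto_zero_iff_norm_tendsto_zero]
    simpa using (tendsto_norm_testPair_fst hΩb hη hbd hw).sqrt
  have h2 : Tendsto (fun n => (p n - q - testPair (hη n)).fst) atTop (𝓝 0) :=
    ((WithLp.fstL 2 ℝ (L2 Ω) (L2Vec Ω)).continuous.tendsto 0).comp hsmall
  have h3 := (h1.add h2).add_const q.fst
  simp only [add_zero, zero_add] at h3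
  refine h3.congr fun n => ?_
  rw [WithLp.sub_fst, WithLp.sub_fst]
  abel

end Rellich

/-! ### Truncation -/

section Truncation

variable {d : ℕ} {Ω : Set (Space d)}

/-- A smooth bounded function which is close to the identity for large `M`. -/
noncomputable def sineTrunc (M s : ℝ) : ℝ := M * Real.sin (s / M)

theorem hasDerivAt_sineTrunc {M : ℝ} (hM : M ≠ 0) (s : ℝ) :
    HasDerivAt (sineTrunc M) (Real.cos (s / M)) s := by
  have h := ((Real.hasDerivAt_sin (s / M)).comp s ((hasDerivAt_id s).div_const M)).const_mul M
  exact h.congr_deriv (by field_simp)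

theorem lipschitzWith_sineTrunc {M : ℝ} (hM : M ≠ 0) : LipschitzWith 1 (sineTrunc M) :=
  lipschitzWith_of_nnnorm_deriv_le (fun s => (hasDerivAt_sineTrunc hM s).differentiableAt)
    fun s => by
      rw [(hasDerivAt_sineTrunc hM s).deriv, ← NNReal.coe_le_coe]
      simpa using Real.abs_cos_le_one _

theorem sineTrunc_zero (M : ℝ) : sineTrunc M 0 = 0 := by simp [sineTrunc]

theorem abs_sineTrunc_le_self {M : ℝ} (hM : M ≠ 0) (s : ℝ) : |sineTrunc M s| ≤ |s| := by
  simpa [sineTrunc_zero] using (lipschitzWith_sineTrunc hM).norm_sub_le s 0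

theorem abs_sineTrunc_le (M s : ℝ) : |sineTrunc M s| ≤ |M| := by
  rw [sineTrunc, abs_mul]
  exact mul_le_of_le_one_right (abs_nonneg _) (Real.abs_sin_le_one _)

theorem tendsto_sineTrunc (s : ℝ) :
    Tendsto (fun n : ℕ => sineTrunc ((n : ℝ) + 1) s) atTop (𝓝 s) := by
  have h1 : HasDerivAt (fun t : ℝ => Real.sin (t * s)) s 0 := by
    have h := (Real.hasDerivAt_sin (0 * s)).comp 0 ((hasDerivAt_id (0 : ℝ)).mul_const s)
    exact h.congr_deriv (by simp)
  have h2 := h1.tendsto_slope_zero_right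
  have h3 : Tendsto (fun n : ℕ => ((n : ℝ) + 1)⁻¹) atTop (𝓝[>] 0) := by
    refine tendsto_nhdsWithin_iff.2 ⟨?_, Eventually.of_forall fun n => ?_⟩
    · simpa using tendsto_one_div_add_atTop_nhds_zero_nat (𝕜 := ℝ)
    · exact mem_Ioi.2 (by positivity)
  refine (h2.comp h3).congr fun n => ?_
  simp [sineTrunc, div_eq_inv_mul]

/-- This is the reason for the sine: unlike a cut-off by `min` and `max`, it is smooth and maps test
functions to test functions. -/
theorem IsTest.sineTrunc {η : Space d → ℝ} (hη : IsTest Ω η) (M : ℝ) :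
    IsTest Ω fun x => sineTrunc M (η x) := by
  refine ⟨?_, hη.2.1.comp_left (sineTrunc_zero M), ?_⟩
  · exact contDiff_const.mul (Real.contDiff_sin.comp (hη.1.div_const M))
  · exact (tsupport_comp_subset (sineTrunc_zero M) η).trans hη.2.2

theorem norm_testPair_sineTrunc_le {η : Space d → ℝ} (hη : IsTest Ω η) {M : ℝ} (hM : M ≠ 0) :
    ‖testPair (hη.sineTrunc M)‖ ≤ ‖testPair hη‖ := by
  refine le_of_sq_le_sq ?_ (norm_nonneg _)
  rw [L2Pair.norm_sq_eq, L2Pair.norm_sq_eq]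
  refine add_le_add (pow_le_pow_left₀ (norm_nonneg _) ?_ 2)
    (pow_le_pow_left₀ (norm_nonneg _) ?_ 2)
  · refine Lp.norm_le_norm_of_ae_le ?_
    filter_upwards [testPair_fst hη, testPair_fst (hη.sineTrunc M)] with x h1 h2
    rw [h1, h2]
    exact abs_sineTrunc_le_self hM _
  · refine Lp.norm_le_norm_of_ae_le ?_
    filter_upwards [testPair_snd hη, testPair_snd (hη.sineTrunc M)] with x h1 h2
    rw [h1, h2, gradient_apply, gradient_apply, LinearIsometryEquiv.norm_map,
      LinearIsometryEquiv.norm_map]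
    have h3 := (hasDerivAt_sineTrunc hM (η x)).comp_hasFDerivAt x
      ((hη.1.differentiable (by simp)).differentiableAt (x := x)).hasFDerivAt
    have h4 : fderiv ℝ (fun x => PhaseField.sineTrunc M (η x)) x =
      Real.cos (η x / M) • fderiv ℝ η x := h3.fderiv
    rw [h4, norm_smul]
    exact mul_le_of_le_one_left (norm_nonneg _) (Real.abs_cos_le_one _)

theorem mem_H10_of_weakTendsto {p : ℕ → L2Pair Ω} {q : L2Pair Ω} (hp : ∀ n, p n ∈ H10 Ω)
    (h : WeakTendsto p q) : q ∈ H10 Ω := by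
  have hcl : (H10 Ω).topologicalClosure = H10 Ω :=
    (Submodule.isClosed_topologicalClosure _).submodule_topologicalClosure_eq
  rw [← hcl]
  exact Submodule.mem_topologicalClosure_of_weakTendsto (H10 Ω) hp h

/-- Truncate approximating test functions and take a weak limit; Lipschitz continuity in `L²`
identifies its function part, and no chain rule for Sobolev functions is needed. -/
theorem exists_sineTrunc_mem_H10 {p : L2Pair Ω} (hp : p ∈ H10 Ω) {M : ℝ} (hM : M ≠ 0) :
    ∃ q ∈ H10 Ω, ‖q‖ ≤ ‖p‖ ∧ q.fst =ᵐ[volume.restrict Ω] fun x => sineTrunc M (p.fst x) := by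
  have happrox : ∀ n : ℕ, ∃ η : Space d → ℝ, ∃ hη : IsTest Ω η,
      ‖p - testPair hη‖ < 1 / ((n : ℝ) + 1) := fun n =>
    exists_testPair_norm_sub_lt hp (by positivity)
  choose η hη hlt using happrox
  have hlim : Tendsto (fun n => testPair (hη n)) atTop (𝓝 p) := by
    rw [tendsto_iff_norm_sub_tendsto_zero]
    simp only [norm_sub_rev _ p]
    exact squeeze_zero (fun n => norm_nonneg _) (fun n => (hlt n).le)
      tendsto_one_div_add_atTop_nhds_zero_nat
  obtain ⟨R, hR⟩ := hlim.norm.bddAbove_range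
  obtain ⟨q, σ, hσ, hq⟩ := exists_weakTendsto_subseq
    (x := fun n => testPair ((hη n).sineTrunc M)) (C := R)
    fun n => (norm_testPair_sineTrunc_le (hη n) hM).trans (hR ⟨n, rfl⟩)
  have hlimσ := hlim.comp hσ.tendsto_atTop
  refine ⟨q, mem_H10_of_weakTendsto (fun n => testPair_mem_H10 ((hη (σ n)).sineTrunc M)) hq,
    ?_, ?_⟩
  · refine le_of_forall_pos_le_add fun e he => hq.norm_le ?_
    filter_upwards [hlimσ.norm.eventually_lt_const (u := ‖p‖ + e) (by linarith)] with n hn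
    exact (norm_testPair_sineTrunc_le (hη (σ n)) hM).trans hn.le
  · have hL := lipschitzWith_sineTrunc hM
    have h1 : Tendsto (fun n => hL.compLp (sineTrunc_zero M) (testPair (hη (σ n))).fst) atTop
        (𝓝 (hL.compLp (sineTrunc_zero M) p.fst)) :=
      ((hL.continuous_compLp (sineTrunc_zero M)).tendsto _).comp
        (((WithLp.fstL 2 ℝ (L2 Ω) (L2Vec Ω)).continuous.tendsto p).comp hlimσ)
    have h2 : WeakTendsto (fun n => (testPair ((hη (σ n)).sineTrunc M)).fst) q.fst :=
      WeakTendsto.map hq (WithLp.fstL 2 ℝ (L2 Ω) (L2Vec Ω))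
    have h3 : (fun n => (testPair ((hη (σ n)).sineTrunc M)).fst) =
        fun n => hL.compLp (sineTrunc_zero M) (testPair (hη (σ n))).fst := by
      ext1 n
      refine Lp.ext ?_
      filter_upwards [testPair_fst (hη (σ n)), testPair_fst ((hη (σ n)).sineTrunc M),
        hL.coeFn_compLp (sineTrunc_zero M) (testPair (hη (σ n))).fst] with x h4 h5 h6
      rw [h5, h6, Function.comp_apply, h4]
    rw [h3] at h2
    rw [h2.unique (WeakTendsto.of_tendsto h1)]
    exact hL.coeFn_compLp (sineTrunc_zero M) p.fst

/-- The bounded elements of `V^φ`. -/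
def boundedV (Ω : Set (Space d)) (φ : Space d → ℝ) : Submodule ℝ (L2Pair Ω) where
  carrier := {p | p ∈ V Ω φ ∧ ∃ M : ℝ, ∀ᵐ x ∂(volume.restrict Ω), |p.fst x| ≤ M}
  add_mem' := by
    rintro p q ⟨hp, M, hM⟩ ⟨hq, N, hN⟩
    refine ⟨add_mem hp hq, M + N, ?_⟩
    filter_upwards [hM, hN, Lp.coeFn_add p.fst q.fst] with x h1 h2 h3
    rw [WithLp.add_fst, h3, Pi.add_apply]
    exact (abs_add_le _ _).trans (add_le_add h1 h2)
  zero_mem' := by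
    refine ⟨zero_mem _, 0, ?_⟩
    filter_upwards [Lp.coeFn_zero ℝ 2 (volume.restrict Ω)] with x h
    rw [WithLp.zero_fst, h, Pi.zero_apply, abs_zero]
  smul_mem' := by
    rintro c p ⟨hp, M, hM⟩
    refine ⟨Submodule.smul_mem _ c hp, |c| * M, ?_⟩
    filter_upwards [hM, Lp.coeFn_smul c p.fst] with x h1 h2
    rw [WithLp.smul_fst, h2, Pi.smul_apply, smul_eq_mul, abs_mul]
    gcongr

/-- The truncations of `p` are bounded in `H¹`, and their function parts tend weakly to that of `p`.
Uniqueness of weak gradients identifies the weak limit with `p`; norm density follows because closed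
subspaces are weakly closed. -/
theorem V_le_topologicalClosure_boundedV (hΩo : IsOpen Ω) (φ : Space d → ℝ) :
    V Ω φ ≤ (boundedV Ω φ).topologicalClosure := by
  intro p hp
  have hpos : ∀ n : ℕ, (n : ℝ) + 1 ≠ 0 := fun n => by positivity
  choose q hq hqn hqf using fun n : ℕ => exists_sineTrunc_mem_H10 hp.1 (hpos n)
  have hqV : ∀ n, q n ∈ boundedV Ω φ := by
    refine fun n => ⟨⟨hq n, ?_⟩, |(n : ℝ) + 1|, ?_⟩
    · filter_upwards [hqf n, hp.2] with x h1 h2 hx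
      rw [h1, h2 hx, sineTrunc_zero]
    · filter_upwards [hqf n] with x h1
      rw [h1]
      exact abs_sineTrunc_le _ _
  obtain ⟨r, σ, hσ, hr⟩ := exists_weakTendsto_subseq hqn
  have hrH : r ∈ H10 Ω := mem_H10_of_weakTendsto (fun n => hq (σ n)) hr
  have hfst : WeakTendsto (fun n => (q n).fst) p.fst := by
    intro y
    simp only [L2.inner_def]
    refine tendsto_integral_of_dominated_convergence (fun x => |p.fst x * y x|)
      (fun n => (L2.integrable_inner (𝕜 := ℝ) (q n).fst y).aestronglyMeasurable) ?_ (fun n => ?_) ?_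
    · have := (L2.integrable_inner (𝕜 := ℝ) p.fst y).abs
      refine this.congr (Eventually.of_forall fun x => ?_)
      simp [mul_comm]
    · filter_upwards [hqf n] with x h1
      rw [h1]
      simp only [RCLike.inner_apply, conj_trivial, Real.norm_eq_abs, abs_mul]
      rw [mul_comm]
      exact mul_le_mul_of_nonneg_right (abs_sineTrunc_le_self (hpos n) _) (abs_nonneg _)
    · filter_upwards [ae_all_iff.2 hqf] with x hx
      simp only [hx, RCLike.inner_apply, conj_trivial]
      exact (tendsto_sineTrunc _).const_mul _
  have hrp : r = p := by
    refine eq_of_fst_eq_of_mem_H10 hΩo hrH hp.1 ?_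
    exact (WeakTendsto.map hr (WithLp.fstL 2 ℝ (L2 Ω) (L2Vec Ω))).unique (hfst.comp hσ)
  rw [← hrp]
  exact Submodule.mem_topologicalClosure_of_weakTendsto _ (fun n => hqV (σ n)) hr

theorem exists_boundedV_norm_sub_lt (hΩo : IsOpen Ω) {φ : Space d → ℝ} {p : L2Pair Ω}
    (hp : p ∈ V Ω φ) {δ : ℝ} (hδ : 0 < δ) : ∃ q ∈ boundedV Ω φ, ‖p - q‖ < δ := by
  obtain ⟨q, hq, h⟩ := Metric.mem_closure_iff.1 (V_le_topologicalClosure_boundedV hΩo φ hp) δ hδ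
  exact ⟨q, hq, by rwa [← dist_eq_norm]⟩

end Truncation

/-! ### Bump functions in `V^φ` -/

theorem exists_orthonormal_boundedV {d : ℕ} (hd : 0 < d) {Ω : Set (Space d)} {φ : Space d → ℝ}
    (hball : ∃ c : Space d, ∃ r > 0, Metric.ball c r ⊆ Ω ∧
      ∀ᵐ x ∂(volume.restrict (Metric.ball c r)), φ x = 1) (k : ℕ) :
    ∃ F : Fin (k + 1) → L2Pair Ω, (∀ i, F i ∈ boundedV Ω φ) ∧
      Orthonormal ℝ fun i => (F i).fst := by
  obtain ⟨c, r, hr, hrΩ, hφ⟩ := hball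
  rw [ae_restrict_iff' measurableSet_ball] at hφ
  let e : Space d := EuclideanSpace.single ⟨0, hd⟩ 1
  have he : ‖e‖ = 1 := by simp [e]
  -- The centres lie on a ray from `c` at spacing `s`. Bumps of radius `s / 4` are then disjoint,
  -- and the farthest reaches `s * k + s / 4 < r`.
  set s : ℝ := r / (k + 2) with hs
  have hspos : 0 < s := by positivity
  have hsr : s * (k + 2) = r := by rw [hs]; field_simp
  let z : Fin (k + 1) → Space d := fun i => c + (s * (i : ℕ)) • e
  let ψ : ∀ i, ContDiffBump (z i) := fun i => ⟨s / 8, s / 4, by positivity, by linarith⟩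
  have hsub : ∀ i, Metric.closedBall (z i) (s / 4) ⊆ Metric.ball c r := by
    intro i x hx
    have h1 : dist (z i) c = s * (i : ℕ) := by
      simp only [z, dist_eq_norm, add_sub_cancel_left, norm_smul, he, mul_one, Real.norm_eq_abs]
      exact abs_of_nonneg (by positivity)
    have h2 : ((i : ℕ) : ℝ) ≤ k := by exact_mod_cast Nat.lt_succ_iff.1 i.2
    have h3 := dist_triangle x (z i) c
    rw [Metric.mem_closedBall] at hx
    rw [Metric.mem_ball]
    nlinarith
  have hdisj : ∀ i j, i ≠ j → ∀ x, ψ i x * ψ j x = 0 := by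
    intro i j hij x
    by_contra hne
    have h1 : x ∈ Metric.ball (z i) (s / 4) := by
      rw [← (ψ i).support_eq]; exact left_ne_zero_of_mul hne
    have h2 : x ∈ Metric.ball (z j) (s / 4) := by
      rw [← (ψ j).support_eq]; exact right_ne_zero_of_mul hne
    have h3 : dist (z i) (z j) = s * |((i : ℕ) : ℝ) - (j : ℕ)| := by
      simp only [z, dist_eq_norm, add_sub_add_left_eq_sub, ← sub_smul, norm_smul, he, mul_one,
        Real.norm_eq_abs, ← mul_sub, abs_mul, abs_of_pos hspos]
    have h4 : (1 : ℝ) ≤ |((i : ℕ) : ℝ) - (j : ℕ)| := by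
      have : (1 : ℤ) ≤ |((i : ℕ) : ℤ) - (j : ℕ)| :=
        Int.one_le_abs (sub_ne_zero.2 fun h => hij (Fin.ext (by exact_mod_cast h)))
      exact_mod_cast this
    have h5 := dist_triangle_left (z i) (z j) x
    rw [Metric.mem_ball] at h1 h2
    nlinarith
  have htest : ∀ i, IsTest Ω (ψ i) := fun i =>
    ⟨(ψ i).contDiff, (ψ i).hasCompactSupport, by
      rw [(ψ i).tsupport_eq]; exact (hsub i).trans hrΩ⟩
  have hV : ∀ i, testPair (htest i) ∈ boundedV Ω φ := by
    intro i
    refine ⟨⟨testPair_mem_H10 _, ?_⟩, 1, ?_⟩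
    · filter_upwards [testPair_fst (htest i), ae_restrict_of_ae hφ] with x h1 h2 hx
      rw [h1]
      by_contra hne
      have h3 : x ∈ Metric.ball (z i) (s / 4) := by
        rw [← (ψ i).support_eq]; exact hne
      have h4 := hsub i (Metric.ball_subset_closedBall h3)
      exact hx ⟨hrΩ h4, h2 h4⟩
    · filter_upwards [testPair_fst (htest i)] with x h1
      rw [h1, abs_of_nonneg (ψ i).nonneg]
      exact (ψ i).le_one
  have hne : ∀ i, ‖(testPair (htest i)).fst‖ ≠ 0 := by
    intro i h0
    have h1 := norm_sq_testPair_fst (htest i)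
    rw [h0, zero_pow two_ne_zero] at h1
    have hc : Continuous fun x => ψ i x ^ 2 := (ψ i).continuous.pow 2
    have h2 : 0 < ∫ x, ψ i x ^ 2 := by
      refine hc.integral_pos_of_hasCompactSupport_nonneg_nonzero (x := z i)
        ((ψ i).hasCompactSupport.comp_left (g := fun v : ℝ => v ^ 2) (by simp))
        (fun x => sq_nonneg _) ?_
      rw [(ψ i).one_of_mem_closedBall (Metric.mem_closedBall_self (ψ i).rIn_pos.le)]
      norm_num
    linarith
  refine ⟨fun i => ‖(testPair (htest i)).fst‖⁻¹ • testPair (htest i),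
    fun i => Submodule.smul_mem _ _ (hV i), fun i => ?_, fun i j hij => ?_⟩
  · simp only [WithLp.smul_fst]
    rw [norm_smul, norm_inv, norm_norm, inv_mul_cancel₀ (hne i)]
  · simp only [WithLp.smul_fst, inner_smul_left, inner_smul_right]
    have : ⟪(testPair (htest i)).fst, (testPair (htest j)).fst⟫_ℝ = 0 := by
      rw [L2.inner_def]
      refine integral_eq_zero_of_ae ?_
      filter_upwards [testPair_fst (htest i), testPair_fst (htest j)] with x h1 h2
      rw [h1, h2]
      simpa [mul_comm] using hdisj i j hij x
    rw [this, mul_zero, mul_zero]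

/-! ### Multiplication operators -/

section Multiplication

variable {d : ℕ} {Ω : Set (Space d)} {β : Space d → ℝ}

theorem exists_sqrt_mul_operator (hβ : AEStronglyMeasurable β (volume.restrict Ω)) {C : ℝ}
    (hβC : ∀ᵐ x ∂(volume.restrict Ω), β x ≤ C) :
    ∃ S : L2 Ω →L[ℝ] L2 Ω, ∀ f : L2 Ω, S f =ᵐ[volume.restrict Ω] fun x => √(β x) * f x := by
  have hm : MemLp (fun x => √(β x)) ⊤ (volume.restrict Ω) := by
    refine memLp_top_of_bound (Real.continuous_sqrt.comp_aestronglyMeasurable hβ) (√C) ?_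
    filter_upwards [hβC] with x hx
    rw [Real.norm_eq_abs, abs_of_nonneg (Real.sqrt_nonneg _)]
    exact Real.sqrt_le_sqrt hx
  refine ⟨(ContinuousLinearMap.mul ℝ ℝ).holderL (volume.restrict Ω) ⊤ 2 2 hm.toLp, fun f => ?_⟩
  filter_upwards [(ContinuousLinearMap.mul ℝ ℝ).coeFn_holder (r := 2) hm.toLp f,
    hm.coeFn_toLp] with x h1 h2
  have h3 : (ContinuousLinearMap.mul ℝ ℝ).holderL (volume.restrict Ω) ⊤ 2 2 hm.toLp f =
    (ContinuousLinearMap.mul ℝ ℝ).holder 2 hm.toLp f := rfl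
  rw [h3, h1, h2, ContinuousLinearMap.mul_apply']

theorem inner_sqrt_mul_operator (hβ0 : ∀ᵐ x ∂(volume.restrict Ω), 0 ≤ β x)
    {S : L2 Ω →L[ℝ] L2 Ω} (hS : ∀ f : L2 Ω, S f =ᵐ[volume.restrict Ω] fun x => √(β x) * f x)
    (f g : L2 Ω) : ⟪S f, S g⟫_ℝ = ∫ x in Ω, β x * f x * g x := by
  rw [L2.inner_def]
  refine integral_congr_ae ?_
  filter_upwards [hβ0, hS f, hS g] with x h0 h1 h2
  rw [h1, h2]
  simp only [RCLike.inner_apply, conj_trivial]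
  linear_combination (f x * g x) * Real.mul_self_sqrt h0

end Multiplication

variable {d : ℕ} {Ω : Set (Space d)}

/-! ### Eigenfunctions and eigenvalues -/

theorem isEigenfunction_iff {U : Submodule ℝ (L2Pair Ω)} {β : Space d → ℝ}
    (hβ0 : ∀ᵐ x ∂(volume.restrict Ω), 0 ≤ β x) {S : L2 Ω →L[ℝ] L2 Ω}
    (hS : ∀ f : L2 Ω, S f =ᵐ[volume.restrict Ω] fun x => √(β x) * f x) {μ : ℝ} {w : L2Pair Ω} :
    IsEigenfunction Ω U β μ w ↔ w ∈ U ∧ w.fst ≠ 0 ∧ ∀ η ∈ U,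
      ⟪w.snd, η.snd⟫_ℝ + ⟪S w.fst, S η.fst⟫_ℝ = μ * ⟪w.fst, η.fst⟫_ℝ := by
  have h : ∀ η : L2Pair Ω, ∫ x in Ω, w.fst x * η.fst x = ⟪w.fst, η.fst⟫_ℝ := by
    intro η
    rw [L2.inner_def]
    exact integral_congr_ae (Eventually.of_forall fun x => by simp [mul_comm])
  unfold IsEigenfunction
  simp only [inner_sqrt_mul_operator hβ0 hS, h, ← L2.inner_def]

theorem isEigenfunction_zero_iff {U : Submodule ℝ (L2Pair Ω)} {μ : ℝ} {w : L2Pair Ω} :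
    IsEigenfunction Ω U 0 μ w ↔ w ∈ U ∧ w.fst ≠ 0 ∧ ∀ η ∈ U,
      ⟪w.snd, η.snd⟫_ℝ = μ * ⟪w.fst, η.fst⟫_ℝ := by
  rw [isEigenfunction_iff (β := 0) (S := 0) (Eventually.of_forall fun x => le_rfl) fun f => ?_]
  · simp
  · filter_upwards [Lp.coeFn_zero ℝ 2 (volume.restrict Ω)] with x hx
    simpa using hx

theorem IsEigenfunction.nonneg {U : Submodule ℝ (L2Pair Ω)} {β : Space d → ℝ}
    (hβ0 : ∀ᵐ x ∂(volume.restrict Ω), 0 ≤ β x) {μ : ℝ} {w : L2Pair Ω}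
    (hw : IsEigenfunction Ω U β μ w) : 0 ≤ μ := by
  obtain ⟨hwU, hw0, h⟩ := hw
  have h1 := h w hwU
  have h2 : ∫ x in Ω, w.fst x * w.fst x = ‖w.fst‖ ^ 2 := by
    rw [← real_inner_self_eq_norm_sq, L2.inner_def]
    exact integral_congr_ae (Eventually.of_forall fun x => by simp [pow_two])
  have h3 : 0 ≤ ∫ x in Ω, ⟪w.snd x, w.snd x⟫_ℝ := integral_nonneg fun x => real_inner_self_nonneg
  have h4 : 0 ≤ ∫ x in Ω, β x * w.fst x * w.fst x := by
    refine integral_nonneg_of_ae ?_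
    filter_upwards [hβ0] with x hx
    simp only [Pi.zero_apply, mul_assoc]
    exact mul_nonneg hx (mul_self_nonneg _)
  rw [h2] at h1
  have h5 : 0 < ‖w.fst‖ ^ 2 := pow_pos (norm_pos_iff.2 hw0) 2
  exact nonneg_of_mul_nonneg_left (h1 ▸ add_nonneg h3 h4) h5

theorem bddBelow_eigenvalue_set {U : Submodule ℝ (L2Pair Ω)} {β : Space d → ℝ}
    (hβ0 : ∀ᵐ x ∂(volume.restrict Ω), 0 ≤ β x) (k : ℕ) :
    0 ∈ lowerBounds {μ : ℝ | ∃ w : Fin (k + 1) → L2Pair Ω, Orthonormal ℝ (fun i => (w i).fst) ∧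
      ∀ i, ∃ ν ≤ μ, IsEigenfunction Ω U β ν (w i)} := by
  rintro μ ⟨w, -, hw⟩
  obtain ⟨ν, hν, h⟩ := hw 0
  exact (h.nonneg hβ0).trans hν

theorem IsEigenbasis.monotone_eigenvalue {β : Space d → ℝ}
    (hβ0 : ∀ᵐ x ∂(volume.restrict Ω), 0 ≤ β x) {w : ℕ → L2Pair Ω} (hw : IsEigenbasis Ω β w) :
    Monotone (eigenvalue Ω (H10 Ω) β) := by
  refine monotone_nat_of_le_succ fun k => ?_
  refine csInf_le_csInf ⟨0, bddBelow_eigenvalue_set hβ0 k⟩ ?_ ?_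
  -- The order of the eigenvalues is not yet known, so their sum serves as a common upper bound;
  -- they are nonnegative.
  · refine ⟨∑ i : Fin (k + 1 + 1), eigenvalue Ω (H10 Ω) β i, fun i => w i,
      hw.orthonormal.comp _ Fin.val_injective, fun i => ⟨_, ?_, hw.eigenfunction i⟩⟩
    exact Finset.single_le_sum (f := fun i : Fin (k + 1 + 1) => eigenvalue Ω (H10 Ω) β i)
      (fun j _ => (hw.eigenfunction j).nonneg hβ0) (Finset.mem_univ i)
  · rintro μ ⟨v, hv, h⟩
    exact ⟨fun i => v i.castSucc, hv.comp _ (Fin.castSucc_injective _), fun i => h i.castSucc⟩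

/-! ### Passage to the limit -/

/-- The map `p ↦ (∇p, S p)`, which represents the form `∫ ∇p·∇q + ⟪S p, S q⟫`. -/
noncomputable def formMap (S : L2 Ω →L[ℝ] L2 Ω) : L2Pair Ω →ₗ[ℝ] WithLp 2 (L2Vec Ω × L2 Ω) where
  toFun p := WithLp.toLp 2 (p.snd, S p.fst)
  map_add' p q := by
    rw [WithLp.add_snd, WithLp.add_fst, map_add]
    rfl
  map_smul' c p := by
    rw [WithLp.smul_snd, WithLp.smul_fst, map_smul]
    rfl

theorem inner_formMap (S : L2 Ω →L[ℝ] L2 Ω) (p q : L2Pair Ω) :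
    ⟪formMap S p, formMap S q⟫_ℝ = ⟪p.snd, q.snd⟫_ℝ + ⟪S p.fst, S q.fst⟫_ℝ :=
  WithLp.prod_inner_apply _ _

theorem norm_sq_formMap (S : L2 Ω →L[ℝ] L2 Ω) (p : L2Pair Ω) :
    ‖formMap S p‖ ^ 2 = ‖p.snd‖ ^ 2 + ‖S p.fst‖ ^ 2 := by
  rw [← real_inner_self_eq_norm_sq, inner_formMap, real_inner_self_eq_norm_sq,
    real_inner_self_eq_norm_sq]

/-- `w 0, w 1, …` is a complete system of eigenvectors with eigenvalues `lam 0 ≤ lam 1 ≤ …` of the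
form `∫ ∇p·∇q + ⟪S p, S q⟫` on `H¹₀(Ω)`. -/
structure IsFormEigenbasis (S : L2 Ω →L[ℝ] L2 Ω) (lam : ℕ → ℝ) (w : ℕ → L2Pair Ω) : Prop where
  mem : ∀ k, w k ∈ H10 Ω
  orthonormal : Orthonormal ℝ fun k => (w k).fst
  total : (Submodule.span ℝ (range fun k => (w k).fst)).topologicalClosure = ⊤
  mono : Monotone lam
  eigen : ∀ k, ∀ η ∈ H10 Ω,
    ⟪(w k).snd, η.snd⟫_ℝ + ⟪S (w k).fst, S η.fst⟫_ℝ = lam k * ⟪(w k).fst, η.fst⟫_ℝ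

namespace IsFormEigenbasis

variable {S : L2 Ω →L[ℝ] L2 Ω} {lam : ℕ → ℝ} {w : ℕ → L2Pair Ω}

theorem norm_fst (h : IsFormEigenbasis S lam w) (k : ℕ) : ‖(w k).fst‖ = 1 := h.orthonormal.1 k

theorem energy_eq (h : IsFormEigenbasis S lam w) (k : ℕ) :
    ‖(w k).snd‖ ^ 2 + ‖S (w k).fst‖ ^ 2 = lam k := by
  have := h.eigen k _ (h.mem k)
  rw [real_inner_self_eq_norm_sq, real_inner_self_eq_norm_sq, real_inner_self_eq_norm_sq,
    h.norm_fst, one_pow, mul_one] at this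
  exact this

theorem nonneg (h : IsFormEigenbasis S lam w) (k : ℕ) : 0 ≤ lam k := by
  rw [← h.energy_eq]; positivity

/-- The upper half of the min–max principle: some unit combination of `k + 1` trial functions is
orthogonal to the first `k` eigenfunctions, and there the Rayleigh bound applies. -/
theorem exists_unit_coeff (h : IsFormEigenbasis S lam w) {k : ℕ} {F : Fin (k + 1) → L2Pair Ω}
    (hF : ∀ i, F i ∈ H10 Ω) :
    ∃ c : Fin (k + 1) → ℝ, ∑ i, c i ^ 2 = 1 ∧
      lam k * ‖∑ i, c i • (F i).fst‖ ^ 2 ≤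
        ‖∑ i, c i • (F i).snd‖ ^ 2 + ‖∑ i, c i • S (F i).fst‖ ^ 2 := by
  obtain ⟨c, hc, horth⟩ := exists_unit_coeff_orthogonal (fun i => (F i).fst) fun j => (w j).fst
  have hfst : (∑ i, c i • F i).fst = ∑ i, c i • (F i).fst := by
    exact map_sum (WithLp.fstL 2 ℝ (L2 Ω) (L2Vec Ω)) (fun i => c i • F i) Finset.univ
  have hsnd : (∑ i, c i • F i).snd = ∑ i, c i • (F i).snd := by
    exact map_sum (WithLp.sndL 2 ℝ (L2 Ω) (L2Vec Ω)) (fun i => c i • F i) Finset.univ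
  refine ⟨c, hc, ?_⟩
  have key := eigenvalue_mul_norm_sq_le
    (WithLp.fstL 2 ℝ (L2 Ω) (L2Vec Ω) : L2Pair Ω →ₗ[ℝ] L2 Ω) (formMap S) (U := H10 Ω) (w := w)
    (lam := lam) h.mem h.orthonormal h.total h.mono (fun k η hη => by
      rw [inner_formMap]; exact h.eigen k η hη)
    (k := k) (f := ∑ i, c i • F i) (Submodule.sum_mem _ fun i _ => Submodule.smul_mem _ _ (hF i))
    (fun j hj => by
      change ⟪(w j).fst, (∑ i, c i • F i).fst⟫_ℝ = 0
      rw [hfst]; exact horth j hj)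
  rw [norm_sq_formMap] at key
  change lam k * ‖(∑ i, c i • F i).fst‖ ^ 2 ≤ _ at key
  rw [hfst, hsnd, map_sum] at key
  simpa only [map_smul] using key

end IsFormEigenbasis

theorem norm_sum_smul_eq_one {L : Type*} [NormedAddCommGroup L] [InnerProductSpace ℝ L] {k : ℕ}
    {c : Fin (k + 1) → ℝ} (hc : ∑ i, c i ^ 2 = 1) {v : Fin (k + 1) → L} (hv : Orthonormal ℝ v) :
    ‖∑ i, c i • v i‖ = 1 := by
  have h : ‖∑ i, c i • v i‖ ^ 2 = 1 := by
    rw [← real_inner_self_eq_norm_sq, hv.inner_sum c c, ← hc]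
    exact Finset.sum_congr rfl fun i _ => by simp [pow_two]
  exact (pow_eq_one_iff_of_nonneg (norm_nonneg _) two_ne_zero).1 h

/-- An upper bound for the eigenvalues in terms of approximate trial functions. -/
theorem exists_tendsto_zero_eigenvalue_le {S : ℕ → L2 Ω →L[ℝ] L2 Ω} {lam : ℕ → ℕ → ℝ}
    {w : ℕ → ℕ → L2Pair Ω} (hw : ∀ n, IsFormEigenbasis (S n) (lam n) (w n))
    {k : ℕ} {v F : Fin (k + 1) → L2Pair Ω} (hv : Orthonormal ℝ fun i => (v i).fst)
    {A : ℝ} (hA : ∀ c : Fin (k + 1) → ℝ, ∑ i, c i ^ 2 = 1 → ‖∑ i, c i • (v i).snd‖ ≤ A)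
    (hF : ∀ i, F i ∈ H10 Ω) (hSF : ∀ i, Tendsto (fun n => S n (F i).fst) atTop (𝓝 0))
    {δ : ℝ} (hvF : ∀ i, ‖v i - F i‖ ≤ δ) (hδ1 : (k + 1) * δ ≤ 1) :
    ∃ s : ℕ → ℝ, Tendsto s atTop (𝓝 0) ∧
      ∀ n, lam n k * (1 - (k + 1) * δ) ^ 2 ≤ (A + (k + 1) * δ) ^ 2 + s n := by
  refine ⟨fun n => ((k + 1) * ∑ i, ‖S n (F i).fst‖) ^ 2, ?_, fun n => ?_⟩
  · have h1 : Tendsto (fun n => ∑ i, ‖S n (F i).fst‖) atTop (𝓝 (∑ _i : Fin (k + 1), (0 : ℝ))) :=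
      tendsto_finsetSum _ fun i _ => by simpa using (hSF i).norm
    simpa using (h1.const_mul ((k : ℝ) + 1)).pow 2
  obtain ⟨c, hc, hle⟩ := (hw n).exists_unit_coeff hF
  -- Writing `F = v - (v - F)` shows that replacing `v` by `F` perturbs each sum by at most `(k + 1)
  -- * δ`.
  have e1 : ∑ i, c i • (F i).fst = ∑ i, c i • (v i).fst - ∑ i, c i • (v i - F i).fst := by
    rw [← Finset.sum_sub_distrib]
    exact Finset.sum_congr rfl fun i _ => by rw [WithLp.sub_fst, smul_sub]; abel
  have e2 : ∑ i, c i • (F i).snd = ∑ i, c i • (v i).snd - ∑ i, c i • (v i - F i).snd := by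
    rw [← Finset.sum_sub_distrib]
    exact Finset.sum_congr rfl fun i _ => by rw [WithLp.sub_snd, smul_sub]; abel
  have b1 : 1 - (k + 1) * δ ≤ ‖∑ i, c i • (F i).fst‖ := by
    rw [e1]
    have h1 := norm_sub_norm_le (∑ i, c i • (v i).fst) (∑ i, c i • (v i - F i).fst)
    have h2 := norm_sum_smul_le hc (fun i => (v i - F i).fst)
      fun i => (L2Pair.norm_fst_le _).trans (hvF i)
    rw [norm_sum_smul_eq_one hc hv] at h1
    linarith
  have b2 : ‖∑ i, c i • (F i).snd‖ ≤ A + (k + 1) * δ := by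
    rw [e2]
    refine (norm_sub_le _ _).trans (add_le_add (hA c hc) ?_)
    exact norm_sum_smul_le hc (fun i => (v i - F i).snd)
      fun i => (L2Pair.norm_snd_le _).trans (hvF i)
  have b3 : ‖∑ i, c i • S n (F i).fst‖ ≤ (k + 1) * ∑ i, ‖S n (F i).fst‖ :=
    norm_sum_smul_le hc _ fun i => Finset.single_le_sum (f := fun i => ‖S n (F i).fst‖)
      (fun i _ => norm_nonneg _) (Finset.mem_univ i)
  calc lam n k * (1 - (k + 1) * δ) ^ 2 ≤ lam n k * ‖∑ i, c i • (F i).fst‖ ^ 2 := by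
        have := (hw n).nonneg k
        have : 0 ≤ 1 - (k + 1) * δ := by linarith
        gcongr
    _ ≤ _ := hle
    _ ≤ _ := add_le_add (pow_le_pow_left₀ (norm_nonneg _) b2 2)
      (pow_le_pow_left₀ (norm_nonneg _) b3 2)

/-- The trial-function bound with `v = F` and `δ = 0`; the convergent error sequence is bounded. -/
theorem exists_eigenvalue_le {S : ℕ → L2 Ω →L[ℝ] L2 Ω} {lam : ℕ → ℕ → ℝ}
    {w : ℕ → ℕ → L2Pair Ω} (hw : ∀ n, IsFormEigenbasis (S n) (lam n) (w n)) {φ : Space d → ℝ}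
    (hS0 : ∀ f ∈ boundedV Ω φ, Tendsto (fun n => S n f.fst) atTop (𝓝 0)) {k : ℕ}
    (hF : ∃ F : Fin (k + 1) → L2Pair Ω, (∀ i, F i ∈ boundedV Ω φ) ∧
      Orthonormal ℝ fun i => (F i).fst) :
    ∃ Λ : ℝ, ∀ n, lam n k ≤ Λ := by
  obtain ⟨F, hFV, hFo⟩ := hF
  obtain ⟨s, hs, hle⟩ := exists_tendsto_zero_eigenvalue_le hw hFo (δ := 0) (F := F)
    (fun c hc => norm_sum_smul_le hc (fun i => (F i).snd) fun i =>
      Finset.single_le_sum (f := fun i => ‖(F i).snd‖) (fun i _ => norm_nonneg _)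
        (Finset.mem_univ i))
    (fun i => (hFV i).1.1) (fun i => hS0 _ (hFV i)) (fun i => by simp) (by simp)
  obtain ⟨R, hR⟩ := hs.bddAbove_range
  refine ⟨(((k : ℝ) + 1) * ∑ i, ‖(F i).snd‖) ^ 2 + R, fun n => ?_⟩
  have h1 := hle n
  have h2 : s n ≤ R := hR ⟨n, rfl⟩
  simp only [mul_zero, sub_zero, one_pow, mul_one, add_zero] at h1
  linarith

/-- The limit of the eigenvalues with number `k` is at most every `μ` below which the limit problem
has `k + 1` orthonormal eigenfunctions. -/
theorem limit_eigenvalue_le (hΩo : IsOpen Ω) {S : ℕ → L2 Ω →L[ℝ] L2 Ω} {lam : ℕ → ℕ → ℝ}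
    {w : ℕ → ℕ → L2Pair Ω} (hw : ∀ n, IsFormEigenbasis (S n) (lam n) (w n)) {φ : Space d → ℝ}
    (hS0 : ∀ f ∈ boundedV Ω φ, Tendsto (fun n => S n f.fst) atTop (𝓝 0)) {k : ℕ}
    {v : Fin (k + 1) → L2Pair Ω} (hv : Orthonormal ℝ fun i => (v i).fst) {μ : ℝ}
    (hvμ : ∀ i, ∃ ν ≤ μ, IsEigenfunction Ω (V Ω φ) 0 ν (v i))
    {σ : ℕ → ℕ} (hσ : StrictMono σ) {l : ℝ} (hl : Tendsto (fun j => lam (σ j) k) atTop (𝓝 l)) :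
    l ≤ μ := by
  choose ν hν hvν using hvμ
  simp only [isEigenfunction_zero_iff] at hvν
  -- The gradients of the `v i` are orthogonal too, so the energy of a unit combination is the
  -- average of the `ν i` with weights `c i ^ 2`.
  have hsq : ∀ c : Fin (k + 1) → ℝ, ∑ i, c i ^ 2 = 1 → ‖∑ i, c i • (v i).snd‖ ^ 2 ≤ μ := by
    intro c hc
    have h1 : ∀ i j, ⟪(v i).snd, (v j).snd⟫_ℝ = if i = j then ν i else 0 := by
      intro i j
      rw [(hvν i).2.2 _ (hvν j).1, orthonormal_iff_ite.1 hv i j]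
      split_ifs <;> simp
    rw [← real_inner_self_eq_norm_sq]
    simp only [sum_inner, inner_sum, inner_smul_left, inner_smul_right, h1, conj_trivial]
    simp only [mul_ite, mul_zero, Finset.sum_ite_eq', Finset.mem_univ, if_true]
    calc ∑ i, c i * (c i * ν i) ≤ ∑ i, c i ^ 2 * μ :=
          Finset.sum_le_sum fun i _ => by nlinarith [hν i, sq_nonneg (c i)]
      _ = μ := by rw [← Finset.sum_mul, hc, one_mul]
  have hμ0 : 0 ≤ μ := by
    have := hsq (Pi.single 0 1) (by simp [Pi.single_apply, Finset.sum_ite_eq'])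
    exact (sq_nonneg _).trans this
  have hA : ∀ c : Fin (k + 1) → ℝ, ∑ i, c i ^ 2 = 1 → ‖∑ i, c i • (v i).snd‖ ≤ √μ :=
    fun c hc => Real.le_sqrt_of_sq_le (hsq c hc)
  -- The `v i` need not be bounded, so bounded approximants within `δ` are used: first `n → ∞`, then
  -- `δ → 0`.
  have hδ : ∀ δ : ℝ, 0 < δ → (k + 1) * δ ≤ 1 →
      l * (1 - (k + 1) * δ) ^ 2 ≤ (√μ + (k + 1) * δ) ^ 2 := by
    intro δ hδ hδ1
    choose F hF hlt using fun i => exists_boundedV_norm_sub_lt hΩo (hvν i).1 hδ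
    obtain ⟨s, hs, hle⟩ := exists_tendsto_zero_eigenvalue_le hw hv hA
      (fun i => (hF i).1.1) (fun i => hS0 _ (hF i)) (fun i => (hlt i).le) hδ1
    have h1 := (hs.comp hσ.tendsto_atTop).const_add ((√μ + (k + 1) * δ) ^ 2)
    rw [add_zero] at h1
    exact le_of_tendsto_of_tendsto' (hl.mul_const _) h1 fun j => hle (σ j)
  have c1 : Tendsto (fun δ : ℝ => l * (1 - (k + 1) * δ) ^ 2) (𝓝[>] 0) (𝓝 l) := by
    have : Tendsto (fun δ : ℝ => l * (1 - (k + 1) * δ) ^ 2) (𝓝 0)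
      (𝓝 (l * (1 - (k + 1) * 0) ^ 2)) := Continuous.tendsto (by fun_prop) 0
    simpa using this.mono_left nhdsWithin_le_nhds
  have c2 : Tendsto (fun δ : ℝ => (√μ + (k + 1) * δ) ^ 2) (𝓝[>] 0) (𝓝 μ) := by
    have : Tendsto (fun δ : ℝ => (√μ + (k + 1) * δ) ^ 2) (𝓝 0)
      (𝓝 ((√μ + (k + 1) * 0) ^ 2)) := Continuous.tendsto (by fun_prop) 0
    rw [mul_zero, add_zero, Real.sq_sqrt hμ0] at this
    exact this.mono_left nhdsWithin_le_nhds
  refine le_of_tendsto_of_tendsto c1 c2 ?_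
  have c3 : Tendsto (fun δ : ℝ => (k + 1) * δ) (𝓝[>] 0) (𝓝 0) := by
    have : Tendsto (fun δ : ℝ => (k + 1) * δ) (𝓝 0) (𝓝 ((k + 1) * 0)) :=
      Continuous.tendsto (by fun_prop) 0
    rw [mul_zero] at this
    exact this.mono_left nhdsWithin_le_nhds
  filter_upwards [c3.eventually_lt_const zero_lt_one, self_mem_nhdsWithin] with δ h1 h2
  exact hδ δ h2 h1.le

/-- Weak limits of eigenvectors with convergent eigenvalues solve the limit problem. -/
theorem limit_isEigenfunction (hΩo : IsOpen Ω) (hΩb : Bornology.IsBounded Ω)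
    {S : ℕ → L2 Ω →L[ℝ] L2 Ω} {lam : ℕ → ℝ} {w : ℕ → L2Pair Ω} {φ : Space d → ℝ}
    (hS0 : ∀ f ∈ boundedV Ω φ, Tendsto (fun n => S n f.fst) atTop (𝓝 0))
    (hpen : ∀ (f : ℕ → L2 Ω) (g : L2 Ω) (C : ℝ), Tendsto f atTop (𝓝 g) →
      (∀ n, ‖S n (f n)‖ ≤ C) → ∀ᵐ x ∂(volume.restrict Ω), x ∉ plusSet Ω φ → g x = 0)
    (hwH : ∀ n, w n ∈ H10 Ω) (hw1 : ∀ n, ‖(w n).fst‖ = 1) {Λ : ℝ}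
    (hwΛ : ∀ n, ‖(w n).snd‖ ^ 2 + ‖S n (w n).fst‖ ^ 2 ≤ Λ)
    (heig : ∀ n, ∀ η ∈ H10 Ω,
      ⟪(w n).snd, η.snd⟫_ℝ + ⟪S n (w n).fst, S n η.fst⟫_ℝ = lam n * ⟪(w n).fst, η.fst⟫_ℝ)
    {l : ℝ} (hlam : Tendsto lam atTop (𝓝 l)) {u : L2Pair Ω} (hu : WeakTendsto w u) :
    Tendsto (fun n => (w n).fst) atTop (𝓝 u.fst) ∧ IsEigenfunction Ω (V Ω φ) 0 l u := by
  have huH : u ∈ H10 Ω := mem_H10_of_weakTendsto hwH hu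
  have hsnd : WeakTendsto (fun n => (w n).snd) u.snd := hu.map (WithLp.sndL 2 ℝ (L2 Ω) (L2Vec Ω))
  have hC : ∀ n, ‖w n‖ ≤ √(1 + Λ) := fun n => Real.le_sqrt_of_sq_le (by
    rw [L2Pair.norm_sq_eq, hw1]; nlinarith [hwΛ n, sq_nonneg ‖S n (w n).fst‖])
  have hSb : ∀ n, ‖S n (w n).fst‖ ≤ √Λ := fun n => Real.le_sqrt_of_sq_le (by
    nlinarith [hwΛ n, sq_nonneg ‖(w n).snd‖])
  have hfst := tendsto_fst_of_weakTendsto hΩb hwH huH hC hu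
  refine ⟨hfst, isEigenfunction_zero_iff.2 ⟨⟨huH, hpen _ _ _ hfst hSb⟩, ?_, ?_⟩⟩
  · have h1 : ‖u.fst‖ = 1 := tendsto_nhds_unique hfst.norm (by
      simp only [hw1]; exact tendsto_const_nhds)
    exact norm_ne_zero_iff.1 (by rw [h1]; exact one_ne_zero)
  -- For bounded `η` the cross term of the penalty is at most `√Λ * ‖S n η‖`, which tends to zero;
  -- density then gives all of `V^φ`.
  have hbdd : ∀ η ∈ boundedV Ω φ, ⟪u.snd, η.snd⟫_ℝ = l * ⟪u.fst, η.fst⟫_ℝ := by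
    intro η hη
    have h1 : Tendsto (fun n => ⟪S n (w n).fst, S n η.fst⟫_ℝ) atTop (𝓝 0) := by
      have h2 := (hS0 η hη).norm.const_mul (√Λ)
      rw [norm_zero, mul_zero] at h2
      refine squeeze_zero_norm (fun n => ?_) h2
      exact (norm_inner_le_norm _ _).trans (by gcongr; exact hSb n)
    have h3 := (hsnd η.snd).add h1
    rw [add_zero] at h3
    refine tendsto_nhds_unique h3 ?_
    simp only [heig _ η hη.1.1]
    exact hlam.mul (hfst.inner tendsto_const_nhds)
  intro η hη
  choose q hq hlt using fun n : ℕ => exists_boundedV_norm_sub_lt hΩo hη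
    (δ := 1 / ((n : ℝ) + 1)) (by positivity)
  have hlim : Tendsto q atTop (𝓝 η) := by
    rw [tendsto_iff_norm_sub_tendsto_zero]
    simp only [norm_sub_rev _ η]
    exact squeeze_zero (fun n => norm_nonneg _) (fun n => (hlt n).le)
      tendsto_one_div_add_atTop_nhds_zero_nat
  have h1 : Tendsto (fun n => ⟪u.snd, (q n).snd⟫_ℝ) atTop (𝓝 ⟪u.snd, η.snd⟫_ℝ) :=
    tendsto_const_nhds.inner (((WithLp.sndL 2 ℝ (L2 Ω) (L2Vec Ω)).continuous.tendsto η).comp hlim)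
  have h2 : Tendsto (fun n => l * ⟪u.fst, (q n).fst⟫_ℝ) atTop (𝓝 (l * ⟪u.fst, η.fst⟫_ℝ)) :=
    (tendsto_const_nhds.inner
      (((WithLp.fstL 2 ℝ (L2 Ω) (L2Vec Ω)).continuous.tendsto η).comp hlim)).const_mul l
  refine tendsto_nhds_unique h1 (h2.congr fun n => (hbdd _ (hq n)).symm)

/-- The abstract convergence theorem, which sees the coefficients only through the recovery property
`hS0` and the confinement property `hpen`. The attainment of the infimum defining the limit
eigenvalue comes out of the compactness argument. -/
theorem exists_subseq_tendsto_eigenfunction (hΩo : IsOpen Ω) (hΩb : Bornology.IsBounded Ω)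
    {S : ℕ → L2 Ω →L[ℝ] L2 Ω} {lam : ℕ → ℕ → ℝ} {w : ℕ → ℕ → L2Pair Ω} {φ : Space d → ℝ}
    (hw : ∀ n, IsFormEigenbasis (S n) (lam n) (w n))
    (hS0 : ∀ f ∈ boundedV Ω φ, Tendsto (fun n => S n f.fst) atTop (𝓝 0))
    (hpen : ∀ (σ : ℕ → ℕ) (f : ℕ → L2 Ω) (g : L2 Ω) (C : ℝ), StrictMono σ →
      Tendsto f atTop (𝓝 g) → (∀ n, ‖S (σ n) (f n)‖ ≤ C) →
        ∀ᵐ x ∂(volume.restrict Ω), x ∉ plusSet Ω φ → g x = 0)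
    {k : ℕ} (hF : ∃ F : Fin (k + 1) → L2Pair Ω, (∀ i, F i ∈ boundedV Ω φ) ∧
      Orthonormal ℝ fun i => (F i).fst) :
    ∃ σ : ℕ → ℕ, StrictMono σ ∧ ∃ u : L2Pair Ω,
      IsEigenfunction Ω (V Ω φ) 0 (eigenvalue Ω (V Ω φ) 0 k) u ∧
      Tendsto (fun j => S (σ j) (w (σ j) k).fst) atTop (𝓝 0) ∧
      Tendsto (fun j => w (σ j) k) atTop (𝓝 u) ∧
      Tendsto (fun j => lam (σ j) k) atTop (𝓝 (eigenvalue Ω (V Ω φ) 0 k)) := by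
  obtain ⟨Λ, hΛ⟩ := exists_eigenvalue_le hw hS0 hF
  have hΛi : ∀ n (i : Fin (k + 1)), lam n i ≤ Λ := fun n i =>
    ((hw n).mono (Nat.lt_succ_iff.1 i.2)).trans (hΛ n)
  have hIcc : ∀ n, (fun i : Fin (k + 1) => lam n i) ∈
      Icc (fun _ : Fin (k + 1) => (0 : ℝ)) (fun _ => Λ) :=
    fun n => ⟨fun i => (hw n).nonneg i, fun i => hΛi n i⟩
  obtain ⟨μ, -, τ, hτ, hμ⟩ := isCompact_Icc.tendsto_subseq hIcc
  rw [tendsto_pi_nhds] at hμ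
  -- Bundling the first `k + 1` eigenfunctions into one Hilbert space vector yields a common weakly
  -- convergent subsequence.
  let x : ℕ → PiLp 2 (fun _ : Fin (k + 1) => L2Pair Ω) := fun n =>
    WithLp.toLp 2 fun i => w (τ n) i
  have hx : ∀ n, ‖x n‖ ≤ √((k + 1) * (1 + Λ)) := by
    intro n
    refine Real.le_sqrt_of_sq_le ?_
    rw [PiLp.norm_sq_eq_of_L2]
    refine (Finset.sum_le_card_nsmul _ _ (1 + Λ) fun i _ => ?_).trans_eq (by simp; ring)
    change ‖w (τ n) i‖ ^ 2 ≤ _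
    rw [L2Pair.norm_sq_eq, (hw _).norm_fst]
    nlinarith [(hw (τ n)).energy_eq i, hΛi (τ n) i, sq_nonneg ‖S (τ n) (w (τ n) i).fst‖]
  obtain ⟨a, ρ, hρ, ha⟩ := exists_weakTendsto_subseq hx
  set σ : ℕ → ℕ := τ ∘ ρ with hσdef
  have hσ : StrictMono σ := hτ.comp hρ
  have hlim : ∀ i : Fin (k + 1), Tendsto (fun j => lam (σ j) i) atTop (𝓝 (μ i)) :=
    fun i => (hμ i).comp hρ.tendsto_atTop
  have hweak : ∀ i : Fin (k + 1), WeakTendsto (fun j => w (σ j) i) (a i) := fun i =>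
    ha.map (PiLp.proj 2 (fun _ : Fin (k + 1) => L2Pair Ω) i : _ →L[ℝ] L2Pair Ω)
  have hmain : ∀ i : Fin (k + 1), Tendsto (fun j => (w (σ j) i).fst) atTop (𝓝 (a i).fst) ∧
      IsEigenfunction Ω (V Ω φ) 0 (μ i) (a i) := fun i =>
    limit_isEigenfunction hΩo hΩb (S := fun j => S (σ j)) (Λ := Λ)
      (fun f hf => (hS0 f hf).comp hσ.tendsto_atTop) (fun f g C => hpen σ f g C hσ)
      (fun j => (hw _).mem _) (fun j => (hw _).norm_fst _)
      (fun j => ((hw _).energy_eq _).trans_le (hΛi _ _)) (fun j => (hw _).eigen _)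
      (hlim i) (hweak i)
  -- Strong `L²` convergence preserves orthonormality, so no multiplicity is lost in the limit.
  have hon : Orthonormal ℝ fun i => (a i).fst := by
    rw [orthonormal_iff_ite]
    intro i j
    refine tendsto_nhds_unique ((hmain i).1.inner (hmain j).1) ?_
    have : ∀ n, ⟪(w (σ n) i).fst, (w (σ n) j).fst⟫_ℝ = if i = j then 1 else 0 := by
      intro n
      rw [orthonormal_iff_ite.1 (hw (σ n)).orthonormal (i : ℕ) (j : ℕ)]
      simp [Fin.ext_iff]
    simp only [this]
    exact tendsto_const_nhds
  let m : Fin (k + 1) := Fin.last k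
  have hm : ((m : Fin (k + 1)) : ℕ) = k := rfl
  have hμm : eigenvalue Ω (V Ω φ) 0 k = μ m := by
    refine IsLeast.csInf_eq ⟨⟨fun i => a i, hon, fun i => ⟨μ i, ?_, (hmain i).2⟩⟩, ?_⟩
    · exact le_of_tendsto_of_tendsto' (hlim i) (hlim m) fun j =>
        (hw _).mono (Nat.lt_succ_iff.1 i.2)
    · rintro ν ⟨v, hv, hvν⟩
      exact limit_eigenvalue_le hΩo hw hS0 hv hvν hσ (hlim m)
  have hsnd : WeakTendsto (fun j => (w (σ j) k).snd) (a m).snd :=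
    (hweak m).map (WithLp.sndL 2 ℝ (L2 Ω) (L2Vec Ω))
  have hen : ‖(a m).snd‖ ^ 2 = μ m := by
    have h := isEigenfunction_zero_iff.1 (hmain m).2
    have h1 := h.2.2 _ h.1
    rw [real_inner_self_eq_norm_sq, real_inner_self_eq_norm_sq, hon.1 m, one_pow, mul_one] at h1
    exact h1
  -- Expanding the square, the sum is `lam - 2⟪∇w, ∇u⟫ + ‖∇u‖²`, with limit `μ m - 2 μ m + μ m = 0`.
  -- Both nonnegative summands therefore vanish in the limit.
  have hsum : Tendsto (fun j => ‖(w (σ j) k).snd - (a m).snd‖ ^ 2 + ‖S (σ j) (w (σ j) k).fst‖ ^ 2)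
      atTop (𝓝 0) := by
    have h1 := ((hlim m).sub ((hsnd (a m).snd).const_mul 2)).add_const (‖(a m).snd‖ ^ 2)
    rw [real_inner_self_eq_norm_sq, hen] at h1
    have h2 : μ m - 2 * μ m + μ m = 0 := by ring
    rw [h2] at h1
    refine h1.congr fun j => ?_
    rw [norm_sub_sq_real, hm, ← (hw (σ j)).energy_eq k, ← hen]
    ring
  have hS : Tendsto (fun j => S (σ j) (w (σ j) k).fst) atTop (𝓝 0) := by
    rw [tendsto_zero_iff_norm_tendsto_zero]
    have h1 : Tendsto (fun j => ‖S (σ j) (w (σ j) k).fst‖ ^ 2) atTop (𝓝 0) :=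
      squeeze_zero (fun j => sq_nonneg _) (fun j => le_add_of_nonneg_left (sq_nonneg _)) hsum
    simpa using h1.sqrt
  have hstrong : Tendsto (fun j => w (σ j) k) atTop (𝓝 (a m)) := by
    rw [tendsto_iff_norm_sub_tendsto_zero]
    have h1 : Tendsto (fun j => ‖(w (σ j) k).snd - (a m).snd‖ ^ 2) atTop (𝓝 0) :=
      squeeze_zero (fun j => sq_nonneg _) (fun j => le_add_of_nonneg_right (sq_nonneg _)) hsum
    have h2 := (tendsto_iff_norm_sub_tendsto_zero.1 (hmain m).1).pow 2
    have h3 := h2.add h1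
    simp only [ne_eq, OfNat.ofNat_ne_zero, not_false_eq_true, zero_pow, add_zero] at h3
    have h4 : Tendsto (fun j => ‖w (σ j) k - a m‖ ^ 2) atTop (𝓝 0) := by
      refine h3.congr fun j => ?_
      rw [L2Pair.norm_sq_eq (w (σ j) k - a m), WithLp.sub_fst, WithLp.sub_snd, hm]
    simpa using h4.sqrt
  refine ⟨σ, hσ, a m, ?_, hS, hstrong, ?_⟩
  · rw [hμm]; exact (hmain m).2
  · rw [hμm]; exact hlim m

/-! ### The penalty term -/

namespace IsCoefficientFamily

variable {b : ℝ → ℝ → ℝ} {bbar : ℝ → ℝ} {b₀ : ℝ → ℝ≥0∞}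

theorem zero_one (hb : IsCoefficientFamily b bbar b₀) : b₀ 1 = 0 := by
  obtain ⟨s, hs, h⟩ := hb.surjOn_zero (mem_univ 0)
  exact le_antisymm (h ▸ hb.antitoneOn_zero hs (by simp) hs.2) bot_le

theorem zero_neg_one (hb : IsCoefficientFamily b bbar b₀) : b₀ (-1) = ⊤ := by
  obtain ⟨s, hs, h⟩ := hb.surjOn_zero (mem_univ ⊤)
  exact le_antisymm le_top (h ▸ hb.antitoneOn_zero (by simp) hs hs.1)

theorem bbar_nonneg (hb : IsCoefficientFamily b bbar b₀) {ε : ℝ} (hε : 0 < ε) : 0 ≤ bbar ε :=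
  have h := hb.mapsTo ε hε (x := 0) (by simp)
  h.1.trans h.2

/-- The product is `o(ε ^ (-2/3)) * O(ε) = o(ε ^ (1/3))`. -/
theorem tendsto_bbar_mul_zero (hb : IsCoefficientFamily b bbar b₀) {ε : ℕ → ℝ}
    (hεpos : ∀ n, 0 < ε n) (hε : Tendsto ε atTop (𝓝 0)) {m : ℕ → ℝ} (hm : m =O[atTop] ε) :
    Tendsto (fun n => bbar (ε n) * m n) atTop (𝓝 0) := by
  have hε' : Tendsto ε atTop (𝓝[>] 0) :=
    tendsto_nhdsWithin_iff.2 ⟨hε, Eventually.of_forall hεpos⟩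
  have h1 := (hb.bbar_isLittleO.comp_tendsto hε').mul_isBigO hm
  refine h1.isBigO.trans_tendsto ?_
  have h2 : ∀ n, (ε n) ^ (-(2 / 3) : ℝ) * ε n = ε n ^ (1 / 3 : ℝ) := by
    intro n
    rw [← Real.rpow_add_one (hεpos n).ne']
    norm_num
  simp only [Function.comp_apply, h2]
  simpa using hε.rpow_const (p := 1 / 3) (Or.inr (by norm_num))

/-- If `s n → 1` then the coefficients `b_{ε n}(s n)` tend to zero. -/
theorem tendsto_zero (hb : IsCoefficientFamily b bbar b₀) {ε : ℕ → ℝ} (hεpos : ∀ n, 0 < ε n)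
    {s : ℕ → ℝ} (hs : ∀ n, s n ∈ Icc (-1 : ℝ) 1) (hlim : Tendsto s atTop (𝓝 1)) :
    Tendsto (fun n => b (ε n) (s n)) atTop (𝓝 0) := by
  have h1 : Tendsto (fun n => b₀ (s n)) atTop (𝓝 0) := by
    have := (hb.continuousOn_zero 1 (by simp)).tendsto
    rw [hb.zero_one] at this
    exact this.comp (tendsto_nhdsWithin_iff.2 ⟨hlim, Eventually.of_forall hs⟩)
  have h2 : Tendsto (fun n => ENNReal.ofReal (b (ε n) (s n))) atTop (𝓝 0) :=
    tendsto_of_tendsto_of_tendsto_of_le_of_le tendsto_const_nhds h1 (fun _ => bot_le)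
      fun n => hb.le_zero _ (hεpos n) _ (hs n)
  have h3 := (ENNReal.tendsto_toReal ENNReal.zero_ne_top).comp h2
  refine h3.congr fun n => ?_
  simp [ENNReal.toReal_ofReal (hb.mapsTo _ (hεpos n) (hs n)).1]

/-- If `s n → -1` then the coefficients `b_{ε n}(s n)` tend to infinity. -/
theorem tendsto_atTop (hb : IsCoefficientFamily b bbar b₀) {ε : ℕ → ℝ} (hεpos : ∀ n, 0 < ε n)
    (hε : Tendsto ε atTop (𝓝 0))
    {s : ℕ → ℝ} (hs : ∀ n, s n ∈ Icc (-1 : ℝ) 1) (hlim : Tendsto s atTop (𝓝 (-1))) :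
    Tendsto (fun n => b (ε n) (s n)) atTop atTop := by
  refine Filter.tendsto_atTop.2 fun T => ?_
  have hε' : Tendsto ε atTop (𝓝[>] 0) :=
    tendsto_nhdsWithin_iff.2 ⟨hε, Eventually.of_forall hεpos⟩
  have h1 := (hb.continuousOn_zero (-1) (by simp)).tendsto
  rw [hb.zero_neg_one] at h1
  have h2 : ∀ᶠ t in 𝓝[Icc (-1 : ℝ) 1] (-1), ENNReal.ofReal T < b₀ t :=
    h1.eventually_const_lt ENNReal.ofReal_lt_top
  -- A fixed `t > -1` with `b₀ t > T` suffices: eventually `b (ε n) t > T` and `s n < t`, and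
  -- monotonicity carries the bound to `s n`.
  obtain ⟨t, ht, htI⟩ : ∃ t, ENNReal.ofReal T < b₀ t ∧ t ∈ Ioo (-1 : ℝ) 1 := by
    have h3 : 𝓝[Ioo (-1 : ℝ) 1] (-1) ≤ 𝓝[Icc (-1 : ℝ) 1] (-1) :=
      nhdsWithin_mono _ Ioo_subset_Icc_self
    have h4 : (𝓝[Ioo (-1 : ℝ) 1] (-1)).NeBot := left_nhdsWithin_Ioo_neBot (by norm_num)
    exact ((h2.filter_mono h3).and self_mem_nhdsWithin).exists
  have htI' : t ∈ Icc (-1 : ℝ) 1 := Ioo_subset_Icc_self htI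
  have h5 := ((hb.tendsto t htI').comp hε').eventually_const_lt ht
  filter_upwards [h5, hlim.eventually_lt_const htI.1] with n h6 h7
  have h8 : T < b (ε n) t := (ENNReal.ofReal_lt_ofReal_iff'.1 h6).1
  exact h8.le.trans (hb.antitoneOn _ (hεpos n) (hs n) htI' h7.le)

/-- Only the values of `b ε` on `[-1, 1]` are controlled, so it is replaced by its continuous
constant extension from that interval. -/
theorem aestronglyMeasurable (hb : IsCoefficientFamily b bbar b₀) {α : Type*}
    [MeasurableSpace α] {μ : Measure α} {ε : ℝ} (hε : 0 < ε) {ψ : α → ℝ}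
    (hψ : AEStronglyMeasurable ψ μ) (hψ1 : ∀ᵐ x ∂μ, |ψ x| ≤ 1) :
    AEStronglyMeasurable (fun x => b ε (ψ x)) μ := by
  have hc : Continuous (IccExtend
      (by norm_num : (-1 : ℝ) ≤ 1) ((Icc (-1 : ℝ) 1).domRestrict (b ε))) :=
    (hb.continuousOn ε hε).domRestrict.Icc_extend'
  refine (hc.comp_aestronglyMeasurable hψ).congr ?_
  filter_upwards [hψ1] with x hx
  exact IccExtend_of_mem _ _ (abs_le.1 hx)

end IsCoefficientFamily

section Penalty

variable {d : ℕ} {Ω : Set (Space d)} {φ : Space d → ℝ} {φε : ℕ → Space d → ℝ} {ε : ℕ → ℝ}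
  {b : ℝ → ℝ → ℝ} {bbar : ℝ → ℝ} {b₀ : ℝ → ℝ≥0∞}

/-- Chebyshev's inequality: where `φ = 1` and `ψ < 0` the difference exceeds one, so an `L¹` rate is
a rate for the measure. -/
theorem measureReal_plusSet_inter_le (hΩo : IsOpen Ω) {φ ψ : Space d → ℝ}
    (hφ : IntegrableOn φ Ω) (hψ : IntegrableOn ψ Ω) :
    NullMeasurableSet (plusSet Ω φ ∩ {x | ψ x < 0}) (volume.restrict Ω) ∧
    (volume.restrict Ω).real (plusSet Ω φ ∩ {x | ψ x < 0}) ≤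
      ∫ x in plusSet Ω φ ∩ {x | ψ x < 0}, |ψ x - φ x| := by
  have hs : NullMeasurableSet (plusSet Ω φ ∩ {x | ψ x < 0}) (volume.restrict Ω) :=
    (hΩo.measurableSet.nullMeasurableSet.inter
      (hφ.aestronglyMeasurable.aemeasurable.nullMeasurable (measurableSet_singleton 1))).inter
      (hψ.aestronglyMeasurable.aemeasurable.nullMeasurable measurableSet_Iio)
  refine ⟨hs, ?_⟩
  have hsub : plusSet Ω φ ∩ {x | ψ x < 0} ⊆ Ω := fun x hx => hx.1.1
  rw [← Measure.restrict_restrict_of_subset hsub]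
  have hfin : Integrable (fun x => |ψ x - φ x|) (volume.restrict Ω) := (hψ.sub hφ).abs
  have hle : ∀ x ∈ plusSet Ω φ ∩ {x | ψ x < 0}, 1 ≤ |ψ x - φ x| := by
    rintro x ⟨⟨-, h1⟩, h2⟩
    rw [mem_ofPred_eq] at h2
    rw [h1, abs_of_nonpos (by linarith)]
    linarith
  have hae : ∀ᵐ x ∂((volume.restrict Ω).restrict (plusSet Ω φ ∩ {x | ψ x < 0})),
      1 ≤ |ψ x - φ x| := (ae_restrict_iff'₀ hs).2 (Eventually.of_forall hle)
  have hint1 : Integrable (fun _ : Space d => (1 : ℝ))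
      ((volume.restrict Ω).restrict (plusSet Ω φ ∩ {x | ψ x < 0})) :=
    hfin.restrict.mono' aestronglyMeasurable_const (by simpa using hae)
  have h := integral_mono_ae hint1 hfin.restrict hae
  simpa using h

/-- The recovery property. The set `s n` is handled by the rate against `bbar`; on its complement
either `f` vanishes or `φε n ≥ 0`, where `b₀ 0` gives a dominating function. -/
theorem tendsto_penalty_zero (hΩo : IsOpen Ω) (hb : IsCoefficientFamily b bbar b₀)
    (hεpos : ∀ n, 0 < ε n) (hε : Tendsto ε atTop (𝓝 0))
    (hφ : IntegrableOn φ Ω) (hφε : ∀ n, IntegrableOn (φε n) Ω)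
    (hφεbd : ∀ n, ∀ᵐ x ∂(volume.restrict Ω), |φε n x| ≤ 1)
    (hlim : ∀ᵐ x ∂(volume.restrict Ω), Tendsto (fun n => φε n x) atTop (𝓝 (φ x)))
    (hΩb : Bornology.IsBounded Ω)
    (hrate : (fun n => ∫ x in plusSet Ω φ ∩ {x | φε n x < 0}, |φε n x - φ x|) =O[atTop] ε)
    {S : ℕ → L2 Ω →L[ℝ] L2 Ω}
    (hS : ∀ n (f : L2 Ω), S n f =ᵐ[volume.restrict Ω] fun x => √(b (ε n) (φε n x)) * f x)
    {f : L2Pair Ω} (hf : f ∈ boundedV Ω φ) : Tendsto (fun n => S n f.fst) atTop (𝓝 0) := by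
  obtain ⟨⟨-, hf0⟩, M, hM⟩ := hf
  set μ := volume.restrict Ω with hμ
  have hfinμ : IsFiniteMeasure μ := ⟨by simpa [hμ] using hΩb.measure_lt_top⟩
  have hmem : ∀ᵐ x ∂μ, ∀ n, φε n x ∈ Icc (-1 : ℝ) 1 := by
    filter_upwards [ae_all_iff.2 hφεbd] with x hx n using abs_le.1 (hx n)
  have hβ0 : ∀ n, ∀ᵐ x ∂μ, 0 ≤ b (ε n) (φε n x) := fun n => by
    filter_upwards [hmem] with x hx using (hb.mapsTo _ (hεpos n) (hx n)).1
  let G : ℕ → Space d → ℝ := fun n x => b (ε n) (φε n x) * f.fst x * f.fst x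
  have hnorm : ∀ n, ‖S n f.fst‖ ^ 2 = ∫ x, G n x ∂μ := fun n => by
    rw [← real_inner_self_eq_norm_sq, inner_sqrt_mul_operator (hβ0 n) (hS n)]
  have hGi : ∀ n, Integrable (G n) μ := by
    intro n
    refine (L2.integrable_inner (𝕜 := ℝ) (S n f.fst) (S n f.fst)).congr ?_
    filter_upwards [hS n f.fst, hβ0 n] with x h1 h2
    rw [h1]
    simp only [RCLike.inner_apply, conj_trivial, G]
    linear_combination (f.fst x * f.fst x) * Real.mul_self_sqrt h2
  have hfi : Integrable (fun x => f.fst x * f.fst x) μ :=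
    (L2.integrable_inner (𝕜 := ℝ) f.fst f.fst).congr
      (Eventually.of_forall fun x => by simp [pow_two])
  set s : ℕ → Set (Space d) := fun n => plusSet Ω φ ∩ {x | φε n x < 0} with hs
  have hsm : ∀ n, NullMeasurableSet (s n) μ := fun n =>
    (measureReal_plusSet_inter_le hΩo hφ (hφε n)).1
  have hsle : ∀ n, μ.real (s n) ≤ ∫ x in s n, |φε n x - φ x| := fun n =>
    (measureReal_plusSet_inter_le hΩo hφ (hφε n)).2
  have hbad : Tendsto (fun n => ∫ x in s n, G n x ∂μ) atTop (𝓝 0) := by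
    have h1 := (hb.tendsto_bbar_mul_zero hεpos hε hrate).const_mul (M * M)
    rw [mul_zero] at h1
    refine squeeze_zero_norm (fun n => ?_) h1
    have h2 : ‖∫ x in s n, G n x ∂μ‖ ≤ bbar (ε n) * (M * M) * μ.real (s n) := by
      refine norm_setIntegral_le_of_norm_le_const_ae (measure_lt_top _ _) ?_
      refine ae_restrict_of_ae ?_
      filter_upwards [hmem, hM] with x h3 h4
      have h5 := hb.mapsTo _ (hεpos n) (h3 n)
      simp only [G]
      rw [Real.norm_eq_abs, mul_assoc, abs_mul, abs_mul, abs_of_nonneg h5.1]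
      have := (abs_nonneg _).trans h4
      have := hb.bbar_nonneg (hεpos n)
      gcongr
      exact h5.2
    refine h2.trans ?_
    have h6 : 0 ≤ bbar (ε n) * (M * M) :=
      mul_nonneg (hb.bbar_nonneg (hεpos n)) (mul_self_nonneg _)
    refine (mul_le_mul_of_nonneg_left (hsle n) h6).trans_eq ?_
    ring
  have hgood : Tendsto (fun n => ∫ x in (s n)ᶜ, G n x ∂μ) atTop (𝓝 0) := by
    simp only [← integral_indicator₀ (hsm _).compl]
    have h1 := tendsto_integral_of_dominated_convergence (μ := μ)
      (F := fun n => (s n)ᶜ.indicator (G n)) (f := fun _ => 0)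
      (fun x => (b₀ 0).toReal * (f.fst x * f.fst x))
      (fun n => (hGi n).aestronglyMeasurable.indicator₀ (hsm n).compl) (hfi.const_mul _)
      (fun n => ?_) ?_
    · simpa using h1
    · filter_upwards [hmem, hf0, ae_restrict_mem hΩo.measurableSet] with x h2 h3 h4
      have h5 : 0 ≤ (b₀ 0).toReal * (f.fst x * f.fst x) :=
        mul_nonneg ENNReal.toReal_nonneg (mul_self_nonneg _)
      by_cases hx : x ∈ s n
      · simpa [hx] using h5
      rw [indicator_of_mem (mem_compl hx)]
      by_cases hxE : x ∈ plusSet Ω φ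
      · have h6 : 0 ≤ φε n x := not_lt.1 fun h => hx ⟨hxE, h⟩
        have h7 : b (ε n) (φε n x) ≤ (b₀ 0).toReal := by
          rw [← ENNReal.ofReal_le_iff_le_toReal hb.lt_top.ne]
          exact (hb.le_zero _ (hεpos n) _ (h2 n)).trans
            (hb.antitoneOn_zero (by simp) (h2 n) h6)
        have h8 := (hb.mapsTo _ (hεpos n) (h2 n)).1
        simp only [G]
        rw [Real.norm_eq_abs, mul_assoc, abs_mul, abs_of_nonneg h8,
          abs_of_nonneg (mul_self_nonneg _)]
        exact mul_le_mul_of_nonneg_right h7 (mul_self_nonneg _)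
      · simp [G, h3 hxE]
    · filter_upwards [hmem, hf0, hlim] with x h2 h3 h4
      have h5 : Tendsto (fun n => G n x) atTop (𝓝 0) := by
        by_cases hxE : x ∈ plusSet Ω φ
        · rw [hxE.2] at h4
          have := ((hb.tendsto_zero hεpos h2 h4).mul_const (f.fst x)).mul_const (f.fst x)
          simpa [G] using this
        · simp [G, h3 hxE]
      refine squeeze_zero_norm (fun n => ?_) (by simpa only [norm_zero] using h5.norm)
      exact norm_indicator_le_norm_self _ _
  have h0 : Tendsto (fun n => ‖S n f.fst‖ ^ 2) atTop (𝓝 0) := by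
    have h1 := hbad.add hgood
    rw [add_zero] at h1
    refine h1.congr fun n => ?_
    rw [hnorm, integral_add_compl₀ (hsm n) (hGi n)]
  rw [tendsto_zero_iff_norm_tendsto_zero]
  simpa using h0.sqrt

/-- The confinement property. By Fatou, the lower limit of `|S (f n)|` is finite almost everywhere
along an a.e. convergent subsequence, whereas it is infinite where `φ = -1` and `g ≠ 0`. The extra
subsequence `σ` allows later extractions. -/
theorem ae_eq_zero_of_penalty_bounded (hb : IsCoefficientFamily b bbar b₀)
    (hεpos : ∀ n, 0 < ε n) (hε : Tendsto ε atTop (𝓝 0))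
    (hφ : ∀ᵐ x ∂(volume.restrict Ω), φ x = -1 ∨ φ x = 1) (hΩo : IsOpen Ω)
    (hφεbd : ∀ n, ∀ᵐ x ∂(volume.restrict Ω), |φε n x| ≤ 1)
    (hlim : ∀ᵐ x ∂(volume.restrict Ω), Tendsto (fun n => φε n x) atTop (𝓝 (φ x)))
    {S : ℕ → L2 Ω →L[ℝ] L2 Ω}
    (hS : ∀ n (f : L2 Ω), S n f =ᵐ[volume.restrict Ω] fun x => √(b (ε n) (φε n x)) * f x)
    (σ : ℕ → ℕ) (f : ℕ → L2 Ω) (g : L2 Ω) (C : ℝ) (hσ : StrictMono σ)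
    (hfg : Tendsto f atTop (𝓝 g)) (hC : ∀ n, ‖S (σ n) (f n)‖ ≤ C) :
    ∀ᵐ x ∂(volume.restrict Ω), x ∉ plusSet Ω φ → g x = 0 := by
  obtain ⟨ρ, hρ, hae⟩ := (tendstoInMeasure_of_tendsto_Lp hfg).exists_seq_tendsto_ae
  have hbdd : ∀ n, eLpNorm (S (σ (ρ n)) (f (ρ n))) 2 (volume.restrict Ω) ≤ C.toNNReal := by
    intro n
    rw [← Lp.enorm_def, ← ofReal_norm]
    exact ENNReal.ofReal_le_ofReal (hC _)
  have hliminf := ae_bdd_liminf_atTop_of_eLpNorm_bdd two_ne_zero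
    (fun n => (Lp.stronglyMeasurable (S (σ (ρ n)) (f (ρ n)))).measurable) hbdd
  have hSall : ∀ᵐ x ∂(volume.restrict Ω), ∀ n, S (σ (ρ n)) (f (ρ n)) x =
      √(b (ε (σ (ρ n))) (φε (σ (ρ n)) x)) * f (ρ n) x := ae_all_iff.2 fun n => hS _ _
  filter_upwards [hae, hliminf, hSall, hφ, hlim, ae_all_iff.2 hφεbd,
    ae_restrict_mem hΩo.measurableSet] with x h1 h2 h3 h4 h5 h6 h7 hx
  have hφx : φ x = -1 := h4.resolve_right fun h => hx ⟨h7, h⟩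
  by_contra hg
  rw [hφx] at h5
  have hβ := (hb.tendsto_atTop hεpos hε (fun n => abs_le.1 (h6 n)) h5).comp
    (hσ.comp hρ).tendsto_atTop
  have h8 : Tendsto (fun n => ‖S (σ (ρ n)) (f (ρ n)) x‖) atTop atTop := by
    have h9 : ∀ n, ‖S (σ (ρ n)) (f (ρ n)) x‖ =
        √(b (ε (σ (ρ n))) (φε (σ (ρ n)) x)) * ‖f (ρ n) x‖ := fun n => by
      rw [h3, norm_mul, Real.norm_eq_abs (√_), abs_of_nonneg (Real.sqrt_nonneg _)]
    simp only [h9]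
    exact (Real.tendsto_sqrt_atTop.comp hβ).atTop_mul_pos (norm_pos_iff.2 hg) h1.norm
  have h9 : Tendsto (fun n => ‖S (σ (ρ n)) (f (ρ n)) x‖ₑ) atTop (𝓝 ⊤) := by
    simp only [← ofReal_norm]
    exact ENNReal.tendsto_ofReal_nhds_top.2 h8
  rw [h9.liminf_eq] at h2
  exact lt_irrefl _ h2

theorem lintegral_penalty_eq {β : Space d → ℝ} (hβ0 : ∀ᵐ x ∂(volume.restrict Ω), 0 ≤ β x)
    {S : L2 Ω →L[ℝ] L2 Ω} (hS : ∀ f : L2 Ω, S f =ᵐ[volume.restrict Ω] fun x => √(β x) * f x)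
    (f : L2 Ω) : ∫⁻ x in Ω, ENNReal.ofReal (β x * |f x| ^ 2) = ENNReal.ofReal (‖S f‖ ^ 2) := by
  rw [← real_inner_self_eq_norm_sq, L2.inner_def, ofReal_integral_eq_lintegral_ofReal
    (L2.integrable_inner (S f) (S f)) (Eventually.of_forall fun x => real_inner_self_nonneg)]
  refine lintegral_congr_ae ?_
  filter_upwards [hβ0, hS f] with x h0 h1
  congr 1
  rw [h1, real_inner_self_eq_norm_sq, norm_mul, mul_pow, Real.norm_eq_abs, Real.norm_eq_abs,
    sq_abs, sq_abs, Real.sq_sqrt h0]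

theorem exists_subseq_tendsto_ae {φ : Space d → ℝ} (hφ : IntegrableOn φ Ω)
    (hφε : ∀ n, IntegrableOn (φε n) Ω)
    (hconv : Tendsto (fun n => ∫ x in Ω, |φε n x - φ x|) atTop (𝓝 0)) :
    ∃ τ : ℕ → ℕ, StrictMono τ ∧
      ∀ᵐ x ∂(volume.restrict Ω), Tendsto (fun n => φε (τ n) x) atTop (𝓝 (φ x)) := by
  refine TendstoInMeasure.exists_seq_tendsto_ae (tendstoInMeasure_of_tendsto_eLpNorm one_ne_zero
    (fun n => (hφε n).aestronglyMeasurable) hφ.aestronglyMeasurable ?_)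
  have h1 : ∀ n, eLpNorm (φε n - φ) 1 (volume.restrict Ω) =
      ENNReal.ofReal (∫ x in Ω, |φε n x - φ x|) := by
    intro n
    rw [eLpNorm_one_eq_lintegral_enorm]
    exact (ofReal_integral_norm_eq_lintegral_enorm ((hφε n).sub hφ)).symm
  simp only [h1]
  simpa using ENNReal.tendsto_ofReal hconv

end Penalty

end PhaseField

/-! ### Proof of the main theorem -/

theorem mainTheorem4 {d : ℕ} (hd : 0 < d)
    (Ω : Set (Space d)) (hΩo : IsOpen Ω) (hΩb : Bornology.IsBounded Ω)
    (S₀ S₁ : Set (Space d))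
    (b : ℝ → ℝ → ℝ) (bbar : ℝ → ℝ) (b₀ : ℝ → ℝ≥0∞) (hb : IsCoefficientFamily b bbar b₀)
    -- the sharp interface phase field
    (φ : Space d → ℝ) (hφBV : IsBV Ω φ)
    (hφ : ∀ᵐ x ∂(volume.restrict Ω), φ x = -1 ∨ φ x = 1)
    (hφU : InU Ω S₀ S₁ φ)
    (hball : ∃ c : Space d, ∃ r > 0, Metric.ball c r ⊆ Ω ∧
      ∀ᵐ x ∂(volume.restrict (Metric.ball c r)), φ x = 1)
    -- the sequence of interface parameters and the diffuse interface phase fields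
    (ε : ℕ → ℝ) (hεpos : ∀ n, 0 < ε n) (hε : Tendsto ε atTop (𝓝 0))
    (φε : ℕ → Space d → ℝ) (hφεint : ∀ n, IntegrableOn (φε n) Ω)
    (hφεbd : ∀ n, ∀ᵐ x ∂(volume.restrict Ω), |φε n x| ≤ 1)
    (hconv : Tendsto (fun n => ∫ x in Ω, |φε n x - φ x|) atTop (𝓝 0))
    (hrate : (fun n => ∫ x in plusSet Ω φ ∩ {x | φε n x < 0}, |φε n x - φ x|) =O[atTop] ε)
    -- the fixed eigenfunctions of the diffuse interface problems
    (w : ℕ → ℕ → L2Pair Ω) (hw : ∀ n, IsEigenbasis Ω (fun x => b (ε n) (φε n x)) (w n))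
    (k : ℕ) :
    ∃ σ : ℕ → ℕ, StrictMono σ ∧ ∃ u : L2Pair Ω,
      IsEigenfunction Ω (V Ω φ) 0 (eigenvalue Ω (V Ω φ) 0 k) u ∧
      Tendsto (fun j => ∫⁻ x in Ω, ENNReal.ofReal
          (b (ε (σ j)) (φε (σ j) x) * |(w (σ j) k).fst x| ^ 2)) atTop (𝓝 0) ∧
      ∫⁻ x in Ω, b₀ (φ x) * ENNReal.ofReal (|u.fst x| ^ 2) = 0 ∧
      Tendsto (fun j => ‖w (σ j) k - u‖) atTop (𝓝 0) ∧
      Tendsto (fun j => eigenvalue Ω (H10 Ω) (fun x => b (ε (σ j)) (φε (σ j) x)) k) atTop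
        (𝓝 (eigenvalue Ω (V Ω φ) 0 k)) := by
  have hβ : ∀ n, ∀ᵐ x ∂(volume.restrict Ω), b (ε n) (φε n x) ∈ Icc 0 (bbar (ε n)) := fun n => by
    filter_upwards [hφεbd n] with x hx using hb.mapsTo _ (hεpos n) (abs_le.1 hx)
  have hβ0 : ∀ n, ∀ᵐ x ∂(volume.restrict Ω), 0 ≤ b (ε n) (φε n x) :=
    fun n => (hβ n).mono fun x hx => hx.1
  choose S hS using fun n => exists_sqrt_mul_operator
    (hb.aestronglyMeasurable (hεpos n) (hφεint n).aestronglyMeasurable (hφεbd n))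
    ((hβ n).mono fun x hx => hx.2)
  have hform : ∀ n, IsFormEigenbasis (S n)
      (eigenvalue Ω (H10 Ω) fun x => b (ε n) (φε n x)) (w n) := fun n =>
    { mem := fun k => ((hw n).eigenfunction k).1
      orthonormal := (hw n).orthonormal
      total := (hw n).total
      mono := (hw n).monotone_eigenvalue (hβ0 n)
      eigen := fun k => ((isEigenfunction_iff (hβ0 n) (hS n)).1 ((hw n).eigenfunction k)).2.2 }
  -- This first extraction gives the pointwise convergence on which both properties of `S` rest.
  obtain ⟨τ, hτ, hlim⟩ := exists_subseq_tendsto_ae hφBV.1 hφεint hconv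
  have hετ : Tendsto (fun n => ε (τ n)) atTop (𝓝 0) := hε.comp hτ.tendsto_atTop
  have hzero : ∀ f ∈ boundedV Ω φ, Tendsto (fun n => S (τ n) f.fst) atTop (𝓝 0) := fun f hf =>
    tendsto_penalty_zero (ε := fun n => ε (τ n)) (φε := fun n => φε (τ n))
      (S := fun n => S (τ n)) hΩo hb (fun n => hεpos (τ n)) hετ
      hφBV.1 (fun n => hφεint (τ n)) (fun n => hφεbd (τ n)) hlim hΩb
      (hrate.comp_tendsto hτ.tendsto_atTop) (fun n => hS (τ n)) hf
  have hpen := ae_eq_zero_of_penalty_bounded (ε := fun n => ε (τ n)) (φε := fun n => φε (τ n))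
    (S := fun n => S (τ n)) hb (fun n => hεpos (τ n)) hετ hφ hΩo
    (fun n => hφεbd (τ n)) hlim (fun n => hS (τ n))
  obtain ⟨σ, hσ, u, hu, h1, h2, h3⟩ := exists_subseq_tendsto_eigenfunction hΩo hΩb
    (S := fun n => S (τ n))
    (lam := fun n => eigenvalue Ω (H10 Ω) fun x => b (ε (τ n)) (φε (τ n) x))
    (w := fun n => w (τ n)) (fun n => hform (τ n)) hzero hpen
    (exists_orthonormal_boundedV hd hball k)
  refine ⟨τ ∘ σ, hτ.comp hσ, u, hu, ?_, ?_, tendsto_iff_norm_sub_tendsto_zero.1 h2, h3⟩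
  · have h4 : Tendsto (fun j => ENNReal.ofReal (‖S (τ (σ j)) (w (τ (σ j)) k).fst‖ ^ 2)) atTop
        (𝓝 0) := by
      simpa using ENNReal.tendsto_ofReal (h1.norm.pow 2)
    exact h4.congr fun j => (lintegral_penalty_eq (hβ0 _) (hS _) _).symm
  -- Where `φ = -1` the integrand is `⊤ * 0 = 0`, because `u` vanishes there; where `φ = 1` it
  -- vanishes because `b₀ 1 = 0`.
  · rw [lintegral_congr_ae (g := fun _ => 0), lintegral_zero]
    filter_upwards [hφ, hu.1.2] with x h5 h6
    rcases h5 with h5 | h5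
    · have h7 : x ∉ plusSet Ω φ := fun h => by
        have := h.2
        rw [h5] at this
        norm_num at this
      simp [h6 h7]
    · simp [h5, hb.zero_one]
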